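/- Let $\mathcal X$ be a Polish space with its Borel $\sigma$-field, $\mathcal P(\mathcal X)$ the set of Borel probability measures on it, and $\mu\in\mathcal P(\mathcal X)$. Let $\chi:\mathcal X\to\mathbb R^+$ be measurable with $\int\chi\,d\mu<\infty$. Let $\alpha:\mathbb R^+\to\mathbb R^+\cup\{+\infty\}$ be convex and lower semicontinuous with $\alpha(0)=0$, let $\mathrm{dom}\,\alpha=\{\alpha<\infty\}$, and let $\alpha^\circledast(s)=\sup_{t\ge0}\{st-\alpha(t)\}$, $s\ge 0$. Assume * $(A_1)$: $\{s\ge0:\alpha^\circledast(s)<\infty\}=[0,b[$ for some $b\in\,]0,+\infty]$; * $(A_2)$: there are $s_0>0$ and $c>0$ such that $\alpha^\circledast(s)\ge c\,s^2$ for all $s\in[0,s_0]$. Notation. $\tau_\alpha=e^{\alpha}-1$; $L_{\tau_\alpha}(\mathcal X,\mu)$ is the Orlicz space of the ($\mu$-a.e. measurable) $f:\mathcal X\to\mathbb R$ with $\int\tau_\alpha(|f|/\lambda)\,d\mu<\infty$ for some $\lambda>0$, and $\|f\|_{\tau_\alpha}=\inf\{\lambda>0:\int\tau_\alpha(|f|/\lambda)\,d\mu\le1\}$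 is its Luxemburg norm ($+\infty$ if there is no such $\lambda$). $H(\nu|\mu)=\int\log\frac{d\nu}{d\mu}\,d\nu$ if $\nu\ll\mu$, and $+\infty$ otherwise. $\|\chi\cdot(\nu-\mu)\|_{TV}=\int\chi\,d|\nu-\mu|\in[0,+\infty]$, where $|\nu-\mu|$ is the total variation measure of $\nu-\mu$, and $\alpha(+\infty)=\lim_{t\to\infty}\alpha(t)$. For $s_0,c$ as in $(A_2)$ and any $u\in\,]0,1[$ with $\frac{u}{\sqrt{1-u}}\le s_0\sqrt{c}$ and $\frac{u^3}{1-u}\le2$, put $$m_\alpha=e\,\max\left(\frac1{(\alpha^\circledast)^{-1}(2)\sqrt{c(1-u)}},\ \frac1u\right).$$ Then the following holds. (i) The following are equivalent: (1) there is $a>0$ such that $\alpha\left(\frac{\|\chi\cdot(\nu-\mu)\|_{TV}}{a}\right)\le H(\nu|\mu)$ for all $\nu\in\mathcal P(\mathcal X)$; (2) $\chi\in L_{\tau_\alpha}(\mathcal X,\mu)$. (ii) If $\chi\in L_{\tau_\alpha}(\mathcal X,\mu)$, then, for every admissible choice of $s_0,c,u$, the inequality in (1) holds with $a=2\sqrt2\,m_\alpha\|\chi\|_{\tau_\alpha}$,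 and more generally with every $a>0$ such that $a\ge2\sqrt2\,m_\alpha\|\chi\|_{\tau_\alpha}$ (if $\|\chi\|_{\tau_\alpha}=0$, this means every $a>0$). (iii) If the inequality in (1) holds with some $a>0$, then $\|\chi\|_{\tau_\alpha}\le3a$ if $\mu$ has no atoms, and $\|\chi\|_{\tau_\alpha}\le3a+\left(\int\chi\,d\mu\right)\|\mathbf 1\|_{\tau_\alpha}$ otherwise. (iv) If $\mathrm{dom}\,\alpha=\mathbb R^+$, then $$\|\chi\|_{\tau_\alpha}\le\inf_{\delta>0}\left\{\frac1\delta\left(1+\frac{\log\int e^{\alpha(\delta\chi)}\,d\mu}{\log2}\right)\right\}.$$ (v) If $\mathrm{dom}\,\alpha=[0,r[$ or $[0,r]$ with $r<\infty$, then $L_{\tau_\alpha}(\mathcal X,\mu)=L_\infty(\mathcal X,\mu)$ and $$r^{-1}\|\chi\|_\infty\le\|\chi\|_{\tau_\alpha}\le\left(\sup\{t>0:\alpha(t)\le\log2\}\right)^{-1}\|\chi\|_\infty .$$ -/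

import Mathlib

open MeasureTheory Set
open scoped NNReal ENNReal

namespace WeightedPinsker

/-- The class `𝒞` of convex lower semicontinuous functions `α : ℝ₊ → ℝ₊ ∪ {+∞}` with
`α 0 = 0`. -/
structure IsConvexLsc (α : ℝ≥0 → ℝ≥0∞) : Prop where
  convex : ConvexOn ℝ≥0 univ α
  lsc : LowerSemicontinuous α
  map_zero : α 0 = 0

/-- The effective domain `{t ≥ 0 : α t < ∞}`. -/
def effDom (α : ℝ≥0 → ℝ≥0∞) : Set ℝ≥0 := {t | α t < ∞}

/-- The monotone conjugate `α⊛ s = sup_{t ≥ 0} (s t - α t)`.  The subtraction of `ℝ≥0∞` is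
truncated at `0`; this does not change the supremum when `α 0 = 0`, because then the term at
`t = 0` is `0`. -/
noncomputable def monConj (α : ℝ≥0 → ℝ≥0∞) (s : ℝ≥0) : ℝ≥0∞ :=
  ⨆ t : ℝ≥0, (s : ℝ≥0∞) * (t : ℝ≥0∞) - α t

/-- Assumption (A₁): the effective domain of `α⊛` is `[0, b[` for some `b ∈ ]0, +∞]`. -/
def AssumptionA1 (α : ℝ≥0 → ℝ≥0∞) : Prop :=
  ∃ b : ℝ≥0∞, 0 < b ∧ effDom (monConj α) = {s : ℝ≥0 | (s : ℝ≥0∞) < b}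

/-- `s₀, c > 0` and `α⊛ s ≥ c s²` for all `s ∈ [0, s₀]`. -/
structure SuperQuadratic (α : ℝ≥0 → ℝ≥0∞) (s₀ c : ℝ≥0) : Prop where
  s₀_pos : 0 < s₀
  c_pos : 0 < c
  le : ∀ s : ℝ≥0, s ≤ s₀ → ((c * s ^ 2 : ℝ≥0) : ℝ≥0∞) ≤ monConj α s

/-- Assumption (A₂): `α⊛` is super-quadratic near `0`. -/
def AssumptionA2 (α : ℝ≥0 → ℝ≥0∞) : Prop :=
  ∃ s₀ c : ℝ≥0, SuperQuadratic α s₀ c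

/-- The value `(α⊛)⁻¹(y)` of the inverse of `α⊛`.  Under (A₁) and (A₂), `α⊛` is an increasing
bijection from `[0, b[` onto `[0, +∞[`, and this is its inverse. -/
noncomputable def monConjInv (α : ℝ≥0 → ℝ≥0∞) (y : ℝ≥0) : ℝ≥0 :=
  sSup {s : ℝ≥0 | monConj α s ≤ (y : ℝ≥0∞)}

/-- The constant `m_α = e max (1 / ((α⊛)⁻¹(2) √(c (1 - u))), 1 / u)`. -/
noncomputable def mConst (α : ℝ≥0 → ℝ≥0∞) (c : ℝ≥0) (u : ℝ) : ℝ :=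
  Real.exp 1 * max (1 / ((monConjInv α 2 : ℝ) * Real.sqrt ((c : ℝ) * (1 - u)))) (1 / u)

/-- The conditions on the parameter `u` in `m_α`. -/
structure AdmissibleU (s₀ c : ℝ≥0) (u : ℝ) : Prop where
  pos : 0 < u
  lt_one : u < 1
  le₁ : u / Real.sqrt (1 - u) ≤ (s₀ : ℝ) * Real.sqrt (c : ℝ)
  le₂ : u ^ 3 / (1 - u) ≤ 2

/-- `exp (α t) ∈ [1, +∞]`, with `exp (+∞) = +∞`. -/
noncomputable def expOf (α : ℝ≥0 → ℝ≥0∞) (t : ℝ≥0) : ℝ≥0∞ :=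
  EReal.exp ((α t : ℝ≥0∞) : EReal)

/-- The Young function `τ_α = exp α - 1`. -/
noncomputable def tau (α : ℝ≥0 → ℝ≥0∞) (t : ℝ≥0) : ℝ≥0∞ := expOf α t - 1

/-- `α` extended to `[0, +∞]` by `α(+∞) = sup α` (the limit of `α` at `+∞`). -/
noncomputable def extendTop (α : ℝ≥0 → ℝ≥0∞) (x : ℝ≥0∞) : ℝ≥0∞ :=
  open Classical in if x = ∞ then ⨆ t, α t else α x.toNNReal

variable {X : Type*} [MeasurableSpace X]

/-- `f` belongs to the Orlicz space `L_{τ_α}(X, μ)`. -/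
def MemOrlicz (α : ℝ≥0 → ℝ≥0∞) (μ : Measure X) (f : X → ℝ) : Prop :=
  AEMeasurable f μ ∧ ∃ l : ℝ≥0, 0 < l ∧ ∫⁻ x, tau α (‖f x‖₊ / l) ∂μ < ∞

/-- The Luxemburg norm `‖f‖_{τ_α} = inf {l > 0 : ∫ τ_α(|f| / l) dμ ≤ 1}`, equal to `+∞` if there
is no such `l`. -/
noncomputable def luxNorm (α : ℝ≥0 → ℝ≥0∞) (μ : Measure X) (f : X → ℝ) : ℝ≥0∞ :=
  ⨅ (l : ℝ≥0) (_ : 0 < l ∧ ∫⁻ x, tau α (‖f x‖₊ / l) ∂μ ≤ 1), (l : ℝ≥0∞)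

/-- `‖χ · (ν - μ)‖_TV = ∫ χ d|ν - μ| ∈ [0, +∞]`, where `|ν - μ|` is the total variation measure of
the signed measure `ν - μ` (the positive part plus the negative part). -/
noncomputable def weightedTV (χ : X → ℝ≥0) (ν μ : Measure X) [IsFiniteMeasure ν]
    [IsFiniteMeasure μ] : ℝ≥0∞ :=
  ∫⁻ x, (χ x : ℝ≥0∞) ∂(ν.toSignedMeasure - μ.toSignedMeasure).totalVariation

/-- For all probability measures `ν`, `α(‖χ · (ν - μ)‖_TV / a) ≤ H(ν | μ)`. -/
def PinskerIneq (α : ℝ≥0 → ℝ≥0∞) (χ : X → ℝ≥0) (μ : Measure X) [IsFiniteMeasure μ]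
    (a : ℝ≥0) : Prop :=
  ∀ (ν : Measure X) [IsProbabilityMeasure ν],
    extendTop α (weightedTV χ ν μ / (a : ℝ≥0∞)) ≤ InformationTheory.klDiv ν μ

end WeightedPinsker

open WeightedPinsker

/-! For the inequality, divide `χ` by an admissible `l` so that `∫ exp α(χ) dμ ≤ 2`. Young's
inequality `s t ≤ α t + α⊛ s` then gives `∫ exp(s χ) dμ ≤ 2 exp(α⊛ s)`. For every `φ` with `|φ| ≤ χ`
this makes the centred log-Laplace transform of `φ` at `s` at most `α⊛(a s)`
(`integral_exp_le_monConj`). For small `s` a second-order expansion gives a multiple of `s²`, which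
the quadratic lower bound on `α⊛` absorbs. For large `s`, `α⊛(a s) ≥ 3` and crude bounds suffice.
Taking `φ = ±χ` with the signs of a Hahn decomposition of `ν - μ`, the variational formula for the
entropy yields `s T ≤ H(ν|μ) + α⊛(a s)` with `T` the weighted total variation, and Fenchel-Moreau
duality (`IsConvexLsc.le_of_forall_mul_le`) turns this into `α(T/a) ≤ H(ν|μ)`.

For the converse, test the inequality on `ν = μ(· | s)`, whose entropy is `-log μ(s)`. With `s` a
set where `α(g/a) > y`, this produces exponential tails for `α(g/a)` (`measure_le_exp_neg`), hence
the integrability of `exp α(g/(3a))`. Here `g` is `χ` when there are no atoms, by splitting the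
space into two halves of equal `χ μ`-mass, and `(χ - ∫ χ dμ)⁺` in general.

The remaining norm estimates come from the monotonicity and convexity of `exp α`. -/

namespace WeightedPinsker

/-! ### Convexity of `α` and `τ_α`, and conjugate duality. -/

variable {α : ℝ≥0 → ℝ≥0∞}

lemma expOf_of_eq_top {t : ℝ≥0} (h : α t = ∞) : expOf α t = ∞ := by
  simp [expOf, h]

lemma expOf_of_ne_top {t : ℝ≥0} (h : α t ≠ ∞) :
    expOf α t = ENNReal.ofReal (Real.exp (α t).toReal) := by
  lift α t to ℝ≥0 using h with y hy
  rw [expOf, ← hy]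
  rfl

lemma one_le_expOf (α : ℝ≥0 → ℝ≥0∞) (t : ℝ≥0) : 1 ≤ expOf α t := by
  simp [expOf, EReal.coe_ennreal_nonneg]

lemma tau_add_one (α : ℝ≥0 → ℝ≥0∞) (t : ℝ≥0) : tau α t + 1 = expOf α t :=
  tsub_add_cancel_of_le (one_le_expOf α t)

lemma IsConvexLsc.le_comb (hα : IsConvexLsc α) {p q : ℝ≥0} (hpq : p + q = 1) (x y : ℝ≥0) :
    α (p * x + q * y) ≤ p * α x + q * α y := by
  have := hα.convex.2 (mem_univ x) (mem_univ y) (zero_le : 0 ≤ p) (zero_le : 0 ≤ q) hpq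
  simpa [ENNReal.smul_def] using this

lemma IsConvexLsc.map_mul_le (hα : IsConvexLsc α) {p : ℝ≥0} (hp : p ≤ 1) (x : ℝ≥0) :
    α (p * x) ≤ p * α x := by
  simpa [hα.map_zero] using hα.le_comb (add_tsub_cancel_of_le hp) x 0

lemma IsConvexLsc.monotone (hα : IsConvexLsc α) : Monotone α := by
  intro x y hxy
  rcases eq_or_ne y 0 with rfl | hy
  · simp [le_antisymm hxy zero_le]
  have hp : x / y ≤ 1 := div_le_one_of_le₀ hxy zero_le
  calc α x = α (x / y * y) := by rw [div_mul_cancel₀ _ hy]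
    _ ≤ (x / y : ℝ≥0) * α y := hα.map_mul_le hp y
    _ ≤ 1 * α y := by gcongr; exact_mod_cast hp
    _ = α y := one_mul _

lemma monotone_expOf (h : Monotone α) : Monotone (expOf α) := fun _ _ hxy =>
  EReal.exp_monotone (EReal.coe_ennreal_le_coe_ennreal_iff.2 (h hxy))

lemma monotone_tau (h : Monotone α) : Monotone (tau α) := fun _ _ hxy =>
  tsub_le_tsub_right (monotone_expOf h hxy) 1

lemma IsConvexLsc.expOf_le_comb (hα : IsConvexLsc α) {p q : ℝ≥0} (hpq : p + q = 1)
    (x y : ℝ≥0) : expOf α (p * x + q * y) ≤ p * expOf α x + q * expOf α y := by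
  rcases eq_or_ne p 0 with rfl | hp
  · simp_all
  rcases eq_or_ne q 0 with rfl | hq
  · simp_all
  by_cases hx : α x = ∞
  · simp [expOf_of_eq_top hx, hp]
  by_cases hy : α y = ∞
  · simp [expOf_of_eq_top hy, hq]
  have hle := hα.le_comb hpq x y
  have hfin : (p : ℝ≥0∞) * α x + q * α y ≠ ∞ := by finiteness
  have hr : (α (p * x + q * y)).toReal ≤ p * (α x).toReal + q * (α y).toReal := by
    have := ENNReal.toReal_mono hfin hle
    rwa [ENNReal.toReal_add (by finiteness) (by finiteness), ENNReal.toReal_mul,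
      ENNReal.toReal_mul] at this
  rw [expOf_of_ne_top (ne_top_of_le_ne_top hfin hle), expOf_of_ne_top hx, expOf_of_ne_top hy,
    ← ENNReal.ofReal_coe_nnreal, ← ENNReal.ofReal_coe_nnreal, ← ENNReal.ofReal_mul (by positivity),
    ← ENNReal.ofReal_mul (by positivity), ← ENNReal.ofReal_add (by positivity) (by positivity)]
  apply ENNReal.ofReal_le_ofReal
  refine (Real.exp_le_exp.2 hr).trans ?_
  simpa using convexOn_exp.2 (mem_univ (α x).toReal) (mem_univ (α y).toReal)
    p.coe_nonneg q.coe_nonneg (by exact_mod_cast hpq)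

lemma IsConvexLsc.tau_le_comb (hα : IsConvexLsc α) {p q : ℝ≥0} (hpq : p + q = 1)
    (x y : ℝ≥0) : tau α (p * x + q * y) ≤ p * tau α x + q * tau α y := by
  have h := hα.expOf_le_comb hpq x y
  rw [← tau_add_one α x, ← tau_add_one α y] at h
  refine tsub_le_iff_right.2 (h.trans (le_of_eq ?_))
  have : (p : ℝ≥0∞) + q = 1 := by exact_mod_cast hpq
  rw [mul_add, mul_add, add_add_add_comm, mul_one, mul_one, this]

lemma IsConvexLsc.tau_zero (hα : IsConvexLsc α) : tau α 0 = 0 := by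
  simp [tau, expOf, hα.map_zero]

lemma IsConvexLsc.tau_mul_le (hα : IsConvexLsc α) {p : ℝ≥0} (hp : p ≤ 1) (x : ℝ≥0) :
    tau α (p * x) ≤ p * tau α x := by
  simpa [hα.tau_zero] using hα.tau_le_comb (add_tsub_cancel_of_le hp) x 0

lemma young_le (α : ℝ≥0 → ℝ≥0∞) (s t : ℝ≥0) : (s : ℝ≥0∞) * t ≤ α t + monConj α s := by
  rw [add_comm]
  exact tsub_le_iff_right.1 (le_iSup (fun t : ℝ≥0 => (s : ℝ≥0∞) * t - α t) t)

lemma monotone_monConj (α : ℝ≥0 → ℝ≥0∞) : Monotone (monConj α) := by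
  intro s s' h
  refine iSup_mono fun t => ?_
  gcongr

/-- Since `α t ≤ k α t`, scaling `s` by `k` gains at least a factor `k`. This stands in for the
convexity of `α⊛` with `α⊛ 0 = 0`. -/
lemma mul_monConj_le (α : ℝ≥0 → ℝ≥0∞) {k : ℝ≥0} (hk : 1 ≤ k) (s : ℝ≥0) :
    k * monConj α s ≤ monConj α (k * s) := by
  rw [monConj, ENNReal.mul_iSup]
  refine iSup_le fun t => le_trans ?_ (le_iSup _ t)
  rw [ENNReal.mul_sub (by simp)]
  push_cast
  rw [mul_assoc]
  gcongr
  exact le_mul_of_one_le_left zero_le (by exact_mod_cast hk)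

/-- A supporting line of `α` strictly below its graph at `t₀`. -/
lemma IsConvexLsc.exists_slope (hα : IsConvexLsc α) {t₀ y : ℝ≥0} (hy : (y : ℝ≥0∞) < α t₀) :
    ∃ s : ℝ≥0, ∀ t : ℝ≥0, (s : ℝ≥0∞) * t + y ≤ α t + s * t₀ := by
  have ht₀ : (0 : ℝ) < t₀ := by
    rcases eq_or_ne t₀ 0 with rfl | h
    · simp [hα.map_zero] at hy
    · exact_mod_cast pos_iff_ne_zero.2 h
  -- The slope is the supremum of the slopes from the graph on the left of `t₀` up to the point
  -- `(t₀, y)`.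
  set S : Set ℝ := {r | ∃ t < t₀, α t ≠ ∞ ∧ r = (y - (α t).toReal) / (t₀ - t)} with hS
  have h0 : (y / t₀ : ℝ) ∈ S :=
    ⟨0, by exact_mod_cast ht₀, by simp [hα.map_zero], by simp [hα.map_zero]⟩
  -- Lower semicontinuity bounds these slopes: within `δ` of `t₀` the numerator is nonpositive, and
  -- farther away the denominator is at least `δ`.
  obtain ⟨δ, hδ, hδy⟩ := Metric.eventually_nhds_iff.1 (hα.lsc t₀ y hy)
  have hbdd : BddAbove S := by
    refine ⟨y / δ, ?_⟩
    rintro _ ⟨t, ht, htop, rfl⟩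
    have htr : (0 : ℝ) < t₀ - t := sub_pos.2 (by exact_mod_cast ht)
    by_cases hd : dist t t₀ < δ
    · have := hδy hd
      have h1 : (y : ℝ) ≤ (α t).toReal := by
        simpa using ENNReal.toReal_mono htop this.le
      exact (div_nonpos_of_nonpos_of_nonneg (by linarith) htr.le).trans (by positivity)
    · have : δ ≤ t₀ - t := by
        rw [not_lt, NNReal.dist_eq, abs_sub_comm, abs_of_pos htr] at hd
        exact hd
      have h2 : 0 ≤ (α t).toReal := ENNReal.toReal_nonneg
      have h3 : (y : ℝ) - (α t).toReal ≤ y := by linarith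
      exact div_le_div₀ y.coe_nonneg h3 hδ this
  have hs0 : 0 ≤ sSup S := (by positivity : (0 : ℝ) ≤ y / t₀).trans (le_csSup hbdd h0)
  have key : ∀ t : ℝ≥0, α t ≠ ∞ → sSup S * t + y ≤ (α t).toReal + sSup S * t₀ := by
    intro t htop
    rcases lt_trichotomy t t₀ with ht | rfl | ht
    · have htr : (0 : ℝ) < t₀ - t := sub_pos.2 (by exact_mod_cast ht)
      have := (div_le_iff₀ htr).1 (le_csSup hbdd ⟨t, ht, htop, rfl⟩)
      linarith
    · have : (y : ℝ) ≤ (α t).toReal := by simpa using ENNReal.toReal_mono htop hy.le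
      linarith
    · have htr : (0 : ℝ) < t - t₀ := sub_pos.2 (by exact_mod_cast ht)
      -- Convexity across `t₀`: every slope on the left is at most every slope on the right.
      have : sSup S ≤ ((α t).toReal - y) / (t - t₀) := by
        refine csSup_le ⟨_, h0⟩ ?_
        rintro _ ⟨t', ht', htop', rfl⟩
        have htr' : (0 : ℝ) < t₀ - t' := sub_pos.2 (by exact_mod_cast ht')
        have hd : 0 < t - t' := tsub_pos_of_lt (ht'.trans ht)
        have e1 : ((t - t₀ : ℝ≥0) : ℝ) = t - t₀ := NNReal.coe_sub ht.le
        have e2 : ((t₀ - t' : ℝ≥0) : ℝ) = t₀ - t' := NNReal.coe_sub ht'.le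
        have e3 : ((t - t' : ℝ≥0) : ℝ) = t - t' := NNReal.coe_sub (ht'.trans ht).le
        have hd' : (0 : ℝ) < t - t' := by linarith
        have hpq : (t - t₀) / (t - t') + (t₀ - t') / (t - t') = 1 := by
          rw [← NNReal.coe_inj]
          push_cast
          rw [e1, e2, e3]
          field_simp
          ring
        have hle := hα.le_comb hpq t' t
        have ht₀eq : (t - t₀) / (t - t') * t' + (t₀ - t') / (t - t') * t = t₀ := by
          rw [← NNReal.coe_inj]
          push_cast
          rw [e1, e2, e3]
          field_simp
          ring
        rw [ht₀eq] at hle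
        have := ENNReal.toReal_mono (by finiteness) (hy.le.trans hle)
        rw [ENNReal.toReal_add (by finiteness) (by finiteness), ENNReal.toReal_mul,
          ENNReal.toReal_mul] at this
        simp only [ENNReal.coe_toReal, NNReal.coe_div, e1, e2, e3] at this
        rw [div_mul_eq_mul_div, div_mul_eq_mul_div, ← add_div, le_div_iff₀ hd'] at this
        rw [div_le_div_iff₀ htr' htr]
        linarith
      have := (le_div_iff₀ htr).1 this
      linarith
  lift sSup S to ℝ≥0 using hs0 with s
  refine ⟨s, fun t => ?_⟩
  by_cases htop : α t = ∞
  · simp [htop]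
  · have := key t htop
    lift α t to ℝ≥0 using htop with z hz
    rw [ENNReal.coe_toReal] at this
    have h' : s * t + y ≤ z + s * t₀ := by
      rw [← NNReal.coe_le_coe]
      push_cast
      exact this
    exact_mod_cast h'

/-- The nontrivial half of the Fenchel-Moreau theorem for `α`. -/
lemma IsConvexLsc.le_of_forall_mul_le (hα : IsConvexLsc α) {t : ℝ≥0} {H : ℝ≥0∞}
    (h : ∀ s : ℝ≥0, monConj α s ≠ ∞ → (s : ℝ≥0∞) * t ≤ H + monConj α s) : α t ≤ H := by
  refine le_of_forall_lt fun y hy => ?_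
  lift y to ℝ≥0 using hy.ne_top
  obtain ⟨z, hyz, hz⟩ := ENNReal.lt_iff_exists_nnreal_btwn.1 hy
  obtain ⟨s, hs⟩ := hα.exists_slope hz
  have h1 : monConj α s + z ≤ s * t := by
    have hz' : (z : ℝ≥0∞) ≤ s * t := by simpa [hα.map_zero] using hs 0
    have : monConj α s ≤ s * t - z := by
      refine iSup_le fun t' => ?_
      refine tsub_le_iff_right.2 (ENNReal.le_of_add_le_add_right (a := z) (by simp) ?_)
      rw [add_right_comm, tsub_add_cancel_of_le hz', add_comm (_ * _) (α t')]
      exact hs t'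
    calc monConj α s + z ≤ (s * t - z) + z := by gcongr
      _ = s * t := tsub_add_cancel_of_le hz'
  have hfin : monConj α s ≠ ∞ :=
    ne_top_of_le_ne_top (by finiteness) (le_self_add.trans h1)
  have h2 := h1.trans (h s hfin)
  rw [add_comm] at h2
  exact hyz.trans_le ((ENNReal.add_le_add_iff_right hfin).1 h2)

end WeightedPinsker

/-! ### The Orlicz space and its Luxemburg norm. -/

namespace WeightedPinsker

variable {α : ℝ≥0 → ℝ≥0∞} {X : Type*} [MeasurableSpace X] {μ : Measure X} {f : X → ℝ} {l : ℝ≥0}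

lemma lintegral_tau_add_one [IsProbabilityMeasure μ] (α : ℝ≥0 → ℝ≥0∞) (g : X → ℝ≥0) :
    ∫⁻ x, tau α (g x) ∂μ + 1 = ∫⁻ x, expOf α (g x) ∂μ := by
  simp_rw [← tau_add_one]
  rw [lintegral_add_right _ measurable_const]
  simp

lemma lintegral_tau_le_one_iff [IsProbabilityMeasure μ] (α : ℝ≥0 → ℝ≥0∞) (g : X → ℝ≥0) :
    ∫⁻ x, tau α (g x) ∂μ ≤ 1 ↔ ∫⁻ x, expOf α (g x) ∂μ ≤ 2 := by
  rw [← lintegral_tau_add_one, ← one_add_one_eq_two, ENNReal.add_le_add_iff_right (by simp)]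

lemma luxNorm_le (hl : 0 < l) (h : ∫⁻ x, tau α (‖f x‖₊ / l) ∂μ ≤ 1) : luxNorm α μ f ≤ l :=
  iInf₂_le l ⟨hl, h⟩

lemma luxNorm_lt_iff {b : ℝ≥0∞} : luxNorm α μ f < b ↔
    ∃ l : ℝ≥0, (0 < l ∧ ∫⁻ x, tau α (‖f x‖₊ / l) ∂μ ≤ 1) ∧ (l : ℝ≥0∞) < b := by
  simp [luxNorm, iInf_lt_iff]

/-- The Luxemburg norm is finite exactly on the Orlicz space. -/
lemma memOrlicz_iff_luxNorm_lt_top (hα : IsConvexLsc α) (hf : AEMeasurable f μ) :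
    MemOrlicz α μ f ↔ luxNorm α μ f < ∞ := by
  constructor
  · rintro ⟨-, l, hl, h⟩
    obtain ⟨k, hk⟩ : ∃ k : ℝ≥0, ∫⁻ x, tau α (‖f x‖₊ / l) ∂μ = k :=
      ⟨_, (ENNReal.coe_toNNReal h.ne).symm⟩
    have hk1 : (1 : ℝ≥0) ≤ max 1 k := le_max_left _ _
    have hk0 : max 1 k ≠ 0 := (zero_lt_one.trans_le hk1).ne'
    -- As `τ_α` is convex and vanishes at `0`, enlarging `l` by `max 1 k` divides the integral,
    -- equal to `k`, by at least that factor.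
    refine (luxNorm_le (l := max 1 k * l) (by positivity) ?_).trans_lt ENNReal.coe_lt_top
    calc ∫⁻ x, tau α (‖f x‖₊ / (max 1 k * l)) ∂μ
        ≤ ∫⁻ x, ((max 1 k)⁻¹ : ℝ≥0) * tau α (‖f x‖₊ / l) ∂μ := by
          refine lintegral_mono fun x => ?_
          have : ‖f x‖₊ / (max 1 k * l) = (max 1 k)⁻¹ * (‖f x‖₊ / l) := by
            field_simp
          rw [this]
          exact hα.tau_mul_le (inv_le_one_of_one_le₀ hk1) _
      _ = ((max 1 k)⁻¹ : ℝ≥0) * k := by rw [lintegral_const_mul' _ _ (by simp), hk]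
      _ ≤ 1 := by
          norm_cast
          rw [inv_mul_le_one₀ (by positivity)]
          exact le_max_right _ _
  · intro h
    obtain ⟨l, ⟨hl, hle⟩, -⟩ := luxNorm_lt_iff.1 h
    exact ⟨hf, l, hl, hle.trans_lt (by simp)⟩

/-- If `α` were infinite on all of `]0, ∞[`, then `α⊛` would vanish identically, against its
quadratic lower bound. A positive point of the domain is then scaled down by convexity. -/
lemma exists_pos_le (hα : IsConvexLsc α) (hA2 : AssumptionA2 α) {ε : ℝ≥0} (hε : 0 < ε) :
    ∃ t : ℝ≥0, 0 < t ∧ α t ≤ ε := by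
  obtain ⟨s₀, c, hs⟩ := hA2
  obtain ⟨t, ht, htop⟩ : ∃ t : ℝ≥0, 0 < t ∧ α t ≠ ∞ := by
    by_contra! h
    have h0 : monConj α s₀ = 0 := by
      rw [← nonpos_iff_eq_zero]
      refine iSup_le fun t => ?_
      rcases eq_or_ne t 0 with rfl | ht
      · simp
      · simp [h t (pos_iff_ne_zero.2 ht)]
    have := hs.le s₀ le_rfl
    rw [h0] at this
    simp at this
    rcases this with h | h
    · exact hs.c_pos.ne' h
    · exact hs.s₀_pos.ne' h
  lift α t to ℝ≥0 using htop with z hz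
  have hp : min 1 (ε / (z + 1)) ≤ 1 := min_le_left _ _
  refine ⟨min 1 (ε / (z + 1)) * t, by positivity, (hα.map_mul_le hp t).trans ?_⟩
  rw [← hz]
  norm_cast
  calc min 1 (ε / (z + 1)) * z ≤ ε / (z + 1) * (z + 1) := by
        gcongr
        · exact min_le_right _ _
        · exact le_self_add
    _ = ε := by field_simp

lemma tau_le_one {t : ℝ≥0} (h : α t ≤ ENNReal.ofReal (Real.log 2)) : tau α t ≤ 1 := by
  have htop : α t ≠ ∞ := ne_top_of_le_ne_top (by simp) h
  rw [tau, tsub_le_iff_right, expOf_of_ne_top htop, one_add_one_eq_two]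
  have : (α t).toReal ≤ Real.log 2 := by
    have := ENNReal.toReal_mono (by simp) h
    rwa [ENNReal.toReal_ofReal (Real.log_nonneg (by norm_num))] at this
  calc ENNReal.ofReal (Real.exp (α t).toReal)
      ≤ ENNReal.ofReal (Real.exp (Real.log 2)) := by gcongr
    _ = 2 := by rw [Real.exp_log (by norm_num)]; simp

lemma exists_pos_le_log_two (hα : IsConvexLsc α) (hA2 : AssumptionA2 α) :
    ∃ t : ℝ≥0, 0 < t ∧ α t ≤ ENNReal.ofReal (Real.log 2) :=
  exists_pos_le hα hA2 (Real.toNNReal_pos.2 (Real.log_pos (by norm_num)))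

lemma luxNorm_le_div (hα : IsConvexLsc α) [IsProbabilityMeasure μ] {t M : ℝ≥0} (ht : 0 < t)
    (hM : 0 < M) (h : α t ≤ ENNReal.ofReal (Real.log 2)) (hf : ∀ᵐ x ∂μ, ‖f x‖₊ ≤ M) :
    luxNorm α μ f ≤ (M / t : ℝ≥0) := by
  refine luxNorm_le (by positivity) ?_
  calc ∫⁻ x, tau α (‖f x‖₊ / (M / t)) ∂μ ≤ ∫⁻ _, 1 ∂μ := by
        refine lintegral_mono_ae (hf.mono fun x hx => ?_)
        refine (monotone_tau hα.monotone ?_).trans (tau_le_one h)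
        rw [div_le_iff₀ (by positivity)]
        field_simp
        exact hx
    _ = 1 := by simp

lemma luxNorm_one_lt_top (hα : IsConvexLsc α) (hA2 : AssumptionA2 α) [IsProbabilityMeasure μ] :
    luxNorm α μ (fun _ => (1 : ℝ)) < ∞ := by
  obtain ⟨t, ht, h⟩ := exists_pos_le_log_two hα hA2
  exact (luxNorm_le_div hα ht one_pos h (by simp)).trans_lt ENNReal.coe_lt_top

lemma aemeasurable_tau (hα : IsConvexLsc α) (hf : AEMeasurable f μ) (l : ℝ≥0) :
    AEMeasurable (fun x => tau α (‖f x‖₊ / l)) μ :=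
  (monotone_tau hα.monotone).measurable.comp_aemeasurable (hf.nnnorm.div_const l)

/-- A finite integral forces `|f| / l` into the effective domain almost everywhere. -/
lemma ae_nnnorm_le (hα : IsConvexLsc α) (hf : AEMeasurable f μ) (hl : 0 < l) {r : ℝ≥0}
    (hr : ∀ t, α t ≠ ∞ → t ≤ r) (h : ∫⁻ x, tau α (‖f x‖₊ / l) ∂μ ≠ ∞) :
    ∀ᵐ x ∂μ, ‖f x‖₊ ≤ r * l := by
  filter_upwards [ae_lt_top' (aemeasurable_tau hα hf l) h] with x hx
  rw [← div_le_iff₀ hl]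
  refine hr _ fun htop => hx.ne ?_
  simp [tau, expOf_of_eq_top htop]

/-! ### Bounded effective domain: comparison with `L_∞`. -/

section BoundedDomain

variable {r : ℝ≥0}

lemma memOrlicz_iff_memLp_top (hα : IsConvexLsc α) (hA2 : AssumptionA2 α)
    [IsProbabilityMeasure μ] (hr : ∀ t, α t ≠ ∞ → t ≤ r) (f : X → ℝ) :
    MemOrlicz α μ f ↔ MemLp f ∞ μ := by
  constructor
  · rintro ⟨hf, l, hl, h⟩
    refine memLp_top_of_bound hf.aestronglyMeasurable (r * l) ?_
    filter_upwards [ae_nnnorm_le hα hf hl hr h.ne] with x hx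
    exact_mod_cast hx
  · intro h
    refine (memOrlicz_iff_luxNorm_lt_top hα h.1.aemeasurable).2 ?_
    obtain ⟨t, ht, hlog⟩ := exists_pos_le_log_two hα hA2
    have hfin := h.2
    rw [eLpNorm_exponent_top] at hfin
    refine (luxNorm_le_div hα ht (M := (eLpNormEssSup f μ).toNNReal + 1) (by positivity) hlog
      ?_).trans_lt ENNReal.coe_lt_top
    filter_upwards [ae_le_eLpNormEssSup (f := f) (μ := μ)] with x hx
    have := ENNReal.toNNReal_mono hfin.ne hx
    exact (this.trans le_self_add)

lemma inv_mul_eLpNorm_le_luxNorm (hα : IsConvexLsc α) (hr : ∀ t, α t ≠ ∞ → t ≤ r)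
    (hf : AEMeasurable f μ) : (r : ℝ≥0∞)⁻¹ * eLpNorm f ∞ μ ≤ luxNorm α μ f := by
  refine le_iInf₂ fun l hl => ?_
  rw [mul_comm, ← div_eq_mul_inv]
  refine ENNReal.div_le_of_le_mul ?_
  rw [eLpNorm_exponent_top]
  refine (eLpNormEssSup_le_of_ae_nnnorm_bound
    (ae_nnnorm_le hα hf hl.1 hr (ne_top_of_le_ne_top (by simp) hl.2))).trans ?_
  rw [mul_comm]
  simp

lemma luxNorm_le_inv_iSup_mul (hα : IsConvexLsc α) (hA2 : AssumptionA2 α)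
    [IsProbabilityMeasure μ] (hr : ∀ t, α t ≠ ∞ → t ≤ r) (f : X → ℝ) :
    luxNorm α μ f ≤
      (⨆ (t : ℝ≥0) (_ : 0 < t ∧ α t ≤ ENNReal.ofReal (Real.log 2)), (t : ℝ≥0∞))⁻¹ *
        eLpNorm f ∞ μ := by
  rw [eLpNorm_exponent_top]
  rcases eq_or_ne (eLpNormEssSup f μ) ∞ with htop | htop
  · rw [htop, ENNReal.mul_top]
    · exact le_top
    · refine ENNReal.inv_ne_zero.2 (ne_top_of_le_ne_top (ENNReal.coe_ne_top (r := r)) ?_)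
      exact iSup₂_le fun t ht => by
        exact_mod_cast hr t (ne_top_of_le_ne_top (by simp) ht.2)
  have hae : ∀ᵐ x ∂μ, ‖f x‖₊ ≤ (eLpNormEssSup f μ).toNNReal := by
    filter_upwards [ae_le_eLpNormEssSup (f := f) (μ := μ)] with x hx
    exact ENNReal.toNNReal_mono htop hx
  rcases eq_or_ne (eLpNormEssSup f μ) 0 with h0 | h0
  · rw [h0, mul_zero, nonpos_iff_eq_zero]
    refine le_antisymm (ENNReal.le_of_forall_pos_le_add fun ε hε _ => ?_) zero_le
    obtain ⟨t, ht, hlog⟩ := exists_pos_le_log_two hα hA2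
    rw [zero_add]
    refine (luxNorm_le_div hα ht (M := ε * t) (by positivity) hlog ?_).trans ?_
    · filter_upwards [hae] with x hx
      rw [h0] at hx
      exact hx.trans (by simp)
    · rw [mul_div_cancel_right₀ _ ht.ne']
  · rw [mul_comm, ENNReal.inv_iSup, ENNReal.mul_iInf_of_ne h0 htop]
    refine le_iInf fun t => ?_
    rw [ENNReal.inv_iSup, ENNReal.mul_iInf_of_ne h0 htop]
    refine le_iInf fun ht => ?_
    refine (luxNorm_le_div hα ht.1 (ENNReal.toNNReal_pos h0 htop) ht.2 hae).trans ?_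
    rw [ENNReal.coe_div ht.1.ne', ENNReal.coe_toNNReal htop, div_eq_mul_inv]

end BoundedDomain

/-! ### Full effective domain: the norm estimated by one exponential integral. -/

/-- With `I` the exponential integral and `k = 1 + log I / log 2`, Jensen for the power `1/k ≤ 1`
bounds `∫ exp α(δ χ / k) dμ` by `I^(1/k) ≤ 2`. -/
lemma luxNorm_le_of_effDom_eq_univ (hα : IsConvexLsc α) [IsProbabilityMeasure μ]
    (hdom : effDom α = univ) {χ : X → ℝ≥0} {δ : ℝ≥0} (hδ : 0 < δ) :
    ((luxNorm α μ (fun x => (χ x : ℝ)) : ℝ≥0∞) : EReal) ≤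
      ((1 / (δ : ℝ) : ℝ) : EReal) *
        (1 + ENNReal.log (∫⁻ x, expOf α (δ * χ x) ∂μ) / ((Real.log 2 : ℝ) : EReal)) := by
  have hfin : ∀ t, α t ≠ ∞ := fun t => (hdom ▸ mem_univ t : t ∈ effDom α).ne
  have hlog2 : 0 < Real.log 2 := Real.log_pos (by norm_num)
  have hδ' : (0 : ℝ) < δ := by exact_mod_cast hδ
  have hI1 : 1 ≤ ∫⁻ x, expOf α (δ * χ x) ∂μ := by
    rw [← lintegral_tau_add_one]
    exact le_add_self
  rcases eq_or_ne (∫⁻ x, expOf α (δ * χ x) ∂μ) ∞ with htop | htop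
  · rw [htop, ENNReal.log_top, EReal.top_div_of_pos_ne_top (by exact_mod_cast hlog2)
      (EReal.coe_ne_top _)]
    rw [show (1 : EReal) + ⊤ = ⊤ from EReal.coe_add_top 1, EReal.coe_mul_top_of_pos (by positivity)]
    exact le_top
  set I := (∫⁻ x, expOf α (δ * χ x) ∂μ).toReal with hI
  have hIeq : ∫⁻ x, expOf α (δ * χ x) ∂μ = ENNReal.ofReal I := (ENNReal.ofReal_toReal htop).symm
  have hI1' : 1 ≤ I := by
    simpa using ENNReal.toReal_mono htop hI1
  have hL : 0 ≤ Real.log I := Real.log_nonneg hI1'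
  set k : ℝ := 1 + Real.log I / Real.log 2 with hk
  have hk1 : 1 ≤ k := by
    have : 0 ≤ Real.log I / Real.log 2 := by positivity
    linarith
  have hk0 : 0 < k := by linarith
  have hRHS : ((1 / (δ : ℝ) : ℝ) : EReal) *
      (1 + ENNReal.log (∫⁻ x, expOf α (δ * χ x) ∂μ) / ((Real.log 2 : ℝ) : EReal)) =
      ((k / δ : ℝ) : EReal) := by
    rw [hIeq, ENNReal.log_ofReal_of_pos (by linarith), ← EReal.coe_div, ← EReal.coe_one,
      ← EReal.coe_add, ← EReal.coe_mul]
    rw [hk]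
    congr 1
    ring
  rw [hRHS]
  lift k to ℝ≥0 using hk0.le with κ
  have hκ : 0 < κ := by exact_mod_cast hk0
  rw [← NNReal.coe_div, ← EReal.coe_nnreal_eq_coe_real, EReal.coe_ennreal_le_coe_ennreal_iff]
  refine luxNorm_le (by positivity) ?_
  rw [lintegral_tau_le_one_iff]
  have hw1 : 0 ≤ 1 - (κ : ℝ)⁻¹ := sub_nonneg.2 (inv_le_one_of_one_le₀ hk1)
  have hwL : (κ : ℝ)⁻¹ * Real.log I ≤ Real.log 2 := by
    rw [inv_mul_le_iff₀ hk0, hk, add_mul, div_mul_cancel₀ _ hlog2.ne']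
    linarith
  -- Jensen in pointwise form: `exp(A/k) = I^(1/k) (exp A / I)^(1/k)`, and the last power lies below
  -- the chord `k⁻¹ (exp A / I) + 1 - k⁻¹`, whose integral is `1`.
  have hpt : ∀ x, expOf α (‖(χ x : ℝ)‖₊ / (κ / δ)) ≤
      ENNReal.ofReal (2 * (κ : ℝ)⁻¹ / I) * expOf α (δ * χ x) +
        ENNReal.ofReal (2 * (1 - (κ : ℝ)⁻¹)) := by
    intro x
    have harg : ‖(χ x : ℝ)‖₊ / (κ / δ) = κ⁻¹ * (δ * χ x) := by
      rw [NNReal.nnnorm_eq]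
      field_simp
    have hle : (α (κ⁻¹ * (δ * χ x))).toReal ≤ (κ : ℝ)⁻¹ * (α (δ * χ x)).toReal := by
      have := ENNReal.toReal_mono (ENNReal.mul_ne_top ENNReal.coe_ne_top (hfin _))
        (hα.map_mul_le (inv_le_one_of_one_le₀ (by exact_mod_cast hk1 : 1 ≤ κ)) (δ * χ x))
      simpa using this
    rw [harg, expOf_of_ne_top (hfin _), expOf_of_ne_top (hfin _),
      ← ENNReal.ofReal_mul (by positivity), ← ENNReal.ofReal_add (by positivity) (by positivity)]
    refine ENNReal.ofReal_le_ofReal ?_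
    set A := (α (δ * χ x)).toReal
    have hconv := convexOn_exp.2 (mem_univ (A - Real.log I)) (mem_univ 0)
      (by positivity : 0 ≤ (κ : ℝ)⁻¹) hw1 (by ring)
    simp only [smul_eq_mul, mul_zero, add_zero, Real.exp_zero, mul_one] at hconv
    rw [Real.exp_sub, Real.exp_log (by linarith)] at hconv
    calc Real.exp (α (κ⁻¹ * (δ * χ x))).toReal
        ≤ Real.exp ((κ : ℝ)⁻¹ * Real.log I + (κ : ℝ)⁻¹ * (A - Real.log I)) := by
          rw [Real.exp_le_exp]
          linarith
      _ ≤ 2 * ((κ : ℝ)⁻¹ * (Real.exp A / I) + (1 - (κ : ℝ)⁻¹)) := by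
          rw [Real.exp_add]
          have : Real.exp ((κ : ℝ)⁻¹ * Real.log I) ≤ 2 := by
            rw [← Real.exp_log (by norm_num : (0 : ℝ) < 2)]
            exact Real.exp_le_exp.2 hwL
          gcongr
      _ = _ := by ring
  calc ∫⁻ x, expOf α (‖(χ x : ℝ)‖₊ / (κ / δ)) ∂μ
      ≤ ∫⁻ x, ENNReal.ofReal (2 * (κ : ℝ)⁻¹ / I) * expOf α (δ * χ x) +
        ENNReal.ofReal (2 * (1 - (κ : ℝ)⁻¹)) ∂μ := lintegral_mono hpt
    _ ≤ 2 := by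
      rw [lintegral_add_right _ measurable_const, lintegral_const_mul' _ _ (by simp), hIeq,
        lintegral_const, measure_univ, mul_one, ← ENNReal.ofReal_mul (by positivity),
        ← ENNReal.ofReal_add (by positivity) (by positivity)]
      rw [div_mul_cancel₀ _ (by linarith), ← mul_add, add_sub_cancel]
      simp

end WeightedPinsker

namespace WeightedPinsker

/-! ### The weighted total variation through the Jordan decomposition. -/

section TotalVariation

variable {X : Type*} [MeasurableSpace X]

/-- The relation is kept additive, `ν + n = μ + p`, so that it can be integrated in `ℝ≥0∞` without
subtraction. -/
lemma exists_jordan_sub (ν μ : Measure X) [IsFiniteMeasure ν] [IsFiniteMeasure μ] :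
    ∃ (p n : Measure X) (s : Set X), MeasurableSet s ∧ n s = 0 ∧ p sᶜ = 0 ∧
      (ν.toSignedMeasure - μ.toSignedMeasure).totalVariation = p + n ∧ ν + n = μ + p := by
  set J := (ν.toSignedMeasure - μ.toSignedMeasure).toJordanDecomposition with hJ
  obtain ⟨s, hs, h1, h2⟩ := J.mutuallySingular
  refine ⟨J.posPart, J.negPart, sᶜ, hs.compl, h2, by rwa [compl_compl], rfl, ?_⟩
  have h := SignedMeasure.toSignedMeasure_toJordanDecomposition
    (ν.toSignedMeasure - μ.toSignedMeasure)
  rw [← hJ, JordanDecomposition.toSignedMeasure] at h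
  rw [← Measure.toSignedMeasure_eq_toSignedMeasure_iff, Measure.toSignedMeasure_add,
    Measure.toSignedMeasure_add]
  rw [sub_eq_sub_iff_add_eq_add] at h
  rw [← h, add_comm]

/-- The weighted total variation is attained by the signs of a Hahn decomposition. -/
lemma exists_weightedTV_eq (χ : X → ℝ≥0) (ν μ : Measure X) [IsFiniteMeasure ν]
    [IsFiniteMeasure μ] : ∃ s : Set X, MeasurableSet s ∧
      weightedTV χ ν μ + (∫⁻ x in s, χ x ∂μ + ∫⁻ x in sᶜ, χ x ∂ν) =
        ∫⁻ x in s, χ x ∂ν + ∫⁻ x in sᶜ, χ x ∂μ := by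
  obtain ⟨p, n, s, hs, hn, hp, htv, heq⟩ := exists_jordan_sub ν μ
  refine ⟨s, hs, ?_⟩
  have e1 : ∫⁻ x in s, χ x ∂ν = ∫⁻ x in s, χ x ∂μ + ∫⁻ x in s, χ x ∂p := by
    have := congrArg (fun m => ∫⁻ x in s, (χ x : ℝ≥0∞) ∂m) heq
    simpa [Measure.restrict_add, lintegral_add_measure, Measure.restrict_eq_zero.2 hn] using this
  have e2 : ∫⁻ x in sᶜ, χ x ∂μ = ∫⁻ x in sᶜ, χ x ∂ν + ∫⁻ x in sᶜ, χ x ∂n := by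
    have := congrArg (fun m => ∫⁻ x in sᶜ, (χ x : ℝ≥0∞) ∂m) heq
    simpa [Measure.restrict_add, lintegral_add_measure, Measure.restrict_eq_zero.2 hp]
      using this.symm
  have e3 : ∫⁻ x, χ x ∂p = ∫⁻ x in s, χ x ∂p := by
    rw [← lintegral_add_compl _ hs, setLIntegral_measure_zero _ _ hp, add_zero]
  have e4 : ∫⁻ x, χ x ∂n = ∫⁻ x in sᶜ, χ x ∂n := by
    rw [← lintegral_add_compl _ hs, setLIntegral_measure_zero _ _ hn, zero_add]
  rw [weightedTV, htv, lintegral_add_measure, e1, e2, e3, e4]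
  ring

lemma le_totalVariation_add (ν μ : Measure X) [IsFiniteMeasure ν] [IsFiniteMeasure μ] :
    ν ≤ (ν.toSignedMeasure - μ.toSignedMeasure).totalVariation + μ := by
  obtain ⟨p, n, s, -, -, -, htv, heq⟩ := exists_jordan_sub ν μ
  calc ν ≤ ν + n := Measure.le_add_right le_rfl
    _ = μ + p := heq
    _ ≤ (μ + p) + n := Measure.le_add_right le_rfl
    _ = _ := by rw [htv]; abel

lemma le_totalVariation_add' (ν μ : Measure X) [IsFiniteMeasure ν] [IsFiniteMeasure μ] :
    μ ≤ (ν.toSignedMeasure - μ.toSignedMeasure).totalVariation + ν := by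
  obtain ⟨p, n, s, -, -, -, htv, heq⟩ := exists_jordan_sub ν μ
  calc μ ≤ μ + p := Measure.le_add_right le_rfl
    _ = ν + n := heq.symm
    _ ≤ (ν + n) + p := Measure.le_add_right le_rfl
    _ = _ := by rw [htv]; abel

lemma lintegral_le_weightedTV_add (χ : X → ℝ≥0) (ν μ : Measure X) [IsFiniteMeasure ν]
    [IsFiniteMeasure μ] : ∫⁻ x, χ x ∂ν ≤ weightedTV χ ν μ + ∫⁻ x, χ x ∂μ := by
  rw [weightedTV, ← lintegral_add_measure]
  exact lintegral_mono' (le_totalVariation_add ν μ) le_rfl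

lemma setLIntegral_add_compl_le_weightedTV (χ : X → ℝ≥0) (ν μ : Measure X) [IsFiniteMeasure ν]
    [IsFiniteMeasure μ] {s : Set X} (hs : MeasurableSet s) :
    ∫⁻ x in s, χ x ∂ν + ∫⁻ x in sᶜ, χ x ∂μ ≤
      weightedTV χ ν μ + (∫⁻ x in s, χ x ∂μ + ∫⁻ x in sᶜ, χ x ∂ν) := by
  rw [weightedTV, ← lintegral_add_compl (μ := SignedMeasure.totalVariation _) _ hs,
    add_add_add_comm]
  refine add_le_add ?_ ?_
  · rw [← lintegral_add_measure, ← Measure.restrict_add]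
    exact lintegral_mono' (Measure.restrict_mono le_rfl (le_totalVariation_add ν μ)) le_rfl
  · rw [← lintegral_add_measure, ← Measure.restrict_add]
    exact lintegral_mono' (Measure.restrict_mono le_rfl (le_totalVariation_add' ν μ)) le_rfl

end TotalVariation

/-! ### Entropy of a conditioned measure. -/

section Conditioning

variable {X : Type*} [MeasurableSpace X] {μ : Measure X} [IsProbabilityMeasure μ]

open InformationTheory in
-- The density is `1_s / μ(s)`, so the integral reduces to the two values `klFun (μ(s)⁻¹)` on `s`
-- and `klFun 0 = 1` off `s`.
lemma klDiv_cond {s : Set X} (hs : MeasurableSet s) (h0 : μ s ≠ 0) :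
    klDiv (ProbabilityTheory.cond μ s) μ = ENNReal.ofReal (-Real.log (μ.real s)) := by
  have hprob := ProbabilityTheory.cond_isProbabilityMeasure (μ := μ) h0
  rw [klDiv_eq_lintegral_klFun_of_ac ProbabilityTheory.cond_absolutelyContinuous]
  have hm : 0 < μ.real s := ENNReal.toReal_pos h0 (by simp)
  have hm1 : μ.real s ≤ 1 := measureReal_le_one
  have hd : (ProbabilityTheory.cond μ s).rnDeriv μ =ᵐ[μ] fun x => (μ s)⁻¹ * s.indicator 1 x := by
    filter_upwards [Measure.rnDeriv_smul_left_of_ne_top (μ.restrict s) μ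
      (ENNReal.inv_ne_top.2 h0), Measure.rnDeriv_restrict_self μ hs] with x h1 h2
    rw [ProbabilityTheory.cond, h1, Pi.smul_apply, h2, smul_eq_mul]
  have hcongr : ∫⁻ x, ENNReal.ofReal
      (klFun ((ProbabilityTheory.cond μ s).rnDeriv μ x).toReal) ∂μ =
      ∫⁻ x, s.indicator (fun _ => ENNReal.ofReal (klFun (μ.real s)⁻¹)) x +
        sᶜ.indicator (fun _ => 1) x ∂μ := by
    refine lintegral_congr_ae (hd.mono fun x hx => ?_)
    by_cases hxs : x ∈ s <;> simp [hx, hxs, Measure.real, klFun_zero]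
  rw [hcongr, lintegral_add_left (measurable_const.indicator hs),
    lintegral_indicator_const hs, lintegral_indicator_const hs.compl, one_mul,
    ← ofReal_measureReal (s := s), ← ofReal_measureReal (s := sᶜ), measureReal_compl hs,
    ← ENNReal.ofReal_mul (klFun_nonneg (by positivity)), ← ENNReal.ofReal_add
      (mul_nonneg (klFun_nonneg (by positivity)) hm.le) (by simp)]
  congr 1
  rw [klFun_apply, Real.log_inv]
  simp
  field_simp
  ring

end Conditioning

/-! ### Halving an atomless measure. -/

section Halving

/-- Without atoms the distribution function is continuous, and the intermediate value theorem gives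
a half-line of half the mass. -/
lemma exists_measure_eq_compl (ρ : Measure ℝ) [IsFiniteMeasure ρ] (h : ∀ x, ρ {x} = 0) :
    ∃ s : Set ℝ, MeasurableSet s ∧ ρ s = ρ sᶜ := by
  rcases eq_or_ne ρ 0 with rfl | hρ
  · exact ⟨∅, by simp⟩
  have : NullSingletonClass ρ := ⟨h⟩
  have hM : 0 < ρ.real univ := by
    simpa [Measure.real, ENNReal.toReal_pos_iff] using hρ
  have hF : ∀ t, ρ.real (Iic t) = ∫ x, (Iic t).indicator (fun _ => (1 : ℝ)) x ∂ρ := by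
    intro t
    simp [integral_indicator_const, measurableSet_Iic]
  have hcont : Continuous fun t => ρ.real (Iic t) := by
    simp_rw [hF]
    rw [continuous_iff_continuousAt]
    intro t
    refine continuousAt_of_dominated (bound := fun _ => 1) ?_ ?_ (integrable_const _) ?_
    · exact .of_forall fun t =>
        (measurable_const.indicator measurableSet_Iic).aestronglyMeasurable
    · refine .of_forall fun t => .of_forall fun x => ?_
      by_cases hx : x ≤ t <;> simp [hx]
    · filter_upwards [Measure.ae_ne ρ t] with x hx
      refine (continuousAt_const (y := (Iic t).indicator (fun _ => (1 : ℝ)) x)).congr ?_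
      rcases lt_or_gt_of_ne hx with h | h
      · filter_upwards [lt_mem_nhds h] with y hy
        simp [h.le, hy.le]
      · filter_upwards [gt_mem_nhds h] with y hy
        simp [h, hy]
  have hreal : Filter.Tendsto (fun t => ρ.real (Iic t)) Filter.atTop (nhds (ρ.real univ)) :=
    (ENNReal.tendsto_toReal (by simp)).comp (tendsto_measure_Iic_atTop ρ)
  have hreal' : Filter.Tendsto (fun t => ρ.real (Ici t)) Filter.atBot (nhds (ρ.real univ)) :=
    (ENNReal.tendsto_toReal (by simp)).comp (tendsto_measure_Ici_atBot ρ)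
  obtain ⟨a, ha⟩ := (hreal.eventually_const_le (by linarith : ρ.real univ / 2 < _)).exists
  obtain ⟨b, hb⟩ := (hreal'.eventually_const_le (by linarith : ρ.real univ / 2 < _)).exists
  have hb' : ρ.real (Iic b) ≤ ρ.real univ / 2 := by
    have h1 : ρ.real (Iic b) = ρ.real (Iio b) := measureReal_congr Iio_ae_eq_Iic.symm
    have h2 := measureReal_compl (μ := ρ) (measurableSet_Ici (a := b))
    rw [compl_Ici] at h2
    linarith
  obtain ⟨t, ht⟩ := mem_range_of_exists_le_of_exists_ge hcont ⟨b, hb'⟩ ⟨a, ha⟩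
  refine ⟨Iic t, measurableSet_Iic, ?_⟩
  have h2 := measureReal_compl (μ := ρ) (measurableSet_Iic (a := t))
  simp only at ht
  rw [← measureReal_eq_measureReal_iff, h2, ht]
  ring

/-- On a Polish space, a finite measure without atoms can be halved. -/
lemma exists_setLIntegral_eq_compl {X : Type*} [TopologicalSpace X] [PolishSpace X]
    [MeasurableSpace X] [BorelSpace X] (μ : Measure X) (h : ∀ x, μ {x} = 0)
    (χ : X → ℝ≥0) (hint : ∫⁻ x, χ x ∂μ ≠ ∞) :
    ∃ s : Set X, MeasurableSet s ∧ ∫⁻ x in s, χ x ∂μ = ∫⁻ x in sᶜ, χ x ∂μ := by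
  have hfin : IsFiniteMeasure (μ.withDensity fun x => (χ x : ℝ≥0∞)) := isFiniteMeasure_withDensity hint
  have he := measurableEmbedding_embeddingReal X
  obtain ⟨s, hs, heq⟩ := exists_measure_eq_compl
    ((μ.withDensity fun x => (χ x : ℝ≥0∞)).map (embeddingReal X)) (by
      intro t
      rw [Measure.map_apply he.measurable (measurableSet_singleton t)]
      refine withDensity_absolutelyContinuous _ _ ?_
      have : NullSingletonClass μ := ⟨h⟩
      exact (subsingleton_singleton.preimage he.injective).measure_zero μ)
  refine ⟨embeddingReal X ⁻¹' s, he.measurable hs, ?_⟩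
  rw [Measure.map_apply he.measurable hs, Measure.map_apply he.measurable hs.compl,
    withDensity_apply _ (he.measurable hs), withDensity_apply _ (he.measurable hs.compl)] at heq
  exact heq

end Halving

end WeightedPinsker

/-! ### From the inequality to the norm of the weight. -/

namespace WeightedPinsker

variable {α : ℝ≥0 → ℝ≥0∞} {X : Type*} [MeasurableSpace X] {μ : Measure X} {a : ℝ≥0}

lemma le_extendTop (h : Monotone α) {t : ℝ≥0} {T : ℝ≥0∞} (htT : (t : ℝ≥0∞) ≤ T) :
    α t ≤ extendTop α T := by
  unfold extendTop
  split_ifs with hT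
  · exact le_iSup α t
  · exact h ((ENNReal.le_toNNReal_of_coe_le htT hT))

/-- A function with tails `μ {W > w} ≤ 2 w⁻³` for `w > 1` has integral at most `2`. -/
lemma lintegral_le_two_of_tail [IsProbabilityMeasure μ] {W : X → ℝ≥0∞} (hW : Measurable W)
    (h : ∀ w : ℝ, 1 < w → μ {x | ENNReal.ofReal w < W x} ≤ ENNReal.ofReal (2 * w ^ (-3 : ℝ))) :
    ∫⁻ x, W x ∂μ ≤ 2 := by
  have hfin : ∀ᵐ x ∂μ, W x ≠ ∞ := by
    have hlim : Filter.Tendsto (fun w : ℝ => ENNReal.ofReal (2 * w ^ (-3 : ℝ))) Filter.atTop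
        (nhds 0) := by
      have := (tendsto_rpow_neg_atTop (by norm_num : (0 : ℝ) < 3)).const_mul 2
      simpa using ENNReal.tendsto_ofReal this
    have : μ {x | W x = ∞} ≤ 0 := by
      refine ge_of_tendsto hlim ?_
      filter_upwards [Filter.eventually_gt_atTop 1] with w hw
      refine (measure_mono fun x hx => ?_).trans (h w hw)
      simp only [mem_ofPred_eq] at hx ⊢
      simp [hx]
    rw [ae_iff]
    simpa using this
  have hint : IntegrableOn (fun t : ℝ => 2 * t ^ (-3 : ℝ)) (Ioi 1) :=
    (integrableOn_Ioi_rpow_of_lt (by norm_num) one_pos).const_mul 2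
  calc ∫⁻ x, W x ∂μ = ∫⁻ x, ENNReal.ofReal (W x).toReal ∂μ :=
        lintegral_congr_ae (hfin.mono fun x hx => (ENNReal.ofReal_toReal hx).symm)
    _ = ∫⁻ t in Ioi 0, μ {x | t < (W x).toReal} :=
        lintegral_eq_lintegral_meas_lt μ (.of_forall fun x => ENNReal.toReal_nonneg)
          hW.ennreal_toReal.aemeasurable
    _ = (∫⁻ t in Ioc 0 1, μ {x | t < (W x).toReal}) +
        ∫⁻ t in Ioi 1, μ {x | t < (W x).toReal} := by
        rw [← Ioc_union_Ioi_eq_Ioi zero_le_one,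
          lintegral_union measurableSet_Ioi (Ioc_disjoint_Ioi le_rfl)]
    -- Each of the two terms contributes exactly `1`, since `∫_1^∞ 2 t⁻³ dt = 1`.
    _ ≤ (∫⁻ _ in Ioc (0 : ℝ) 1, 1) + ∫⁻ t in Ioi (1 : ℝ), ENNReal.ofReal (2 * t ^ (-3 : ℝ)) := by
        refine add_le_add (lintegral_mono fun t => prob_le_one)
          (setLIntegral_mono' measurableSet_Ioi fun t ht => ?_)
        refine (measure_mono fun x hx => ?_).trans (h t ht)
        have ht0 : (0 : ℝ) ≤ t := zero_le_one.trans (le_of_lt ht)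
        have hx' : t < (W x).toReal := hx
        by_cases hxt : W x = ∞
        · simp [hxt]
        · exact (ENNReal.ofReal_lt_iff_lt_toReal ht0 hxt).2 hx'
    _ = 2 := by
        rw [← ofReal_integral_eq_lintegral_ofReal hint, integral_const_mul,
          integral_Ioi_rpow_of_lt (by norm_num) one_pos]
        · norm_num
        · filter_upwards [ae_restrict_mem measurableSet_Ioi] with t ht
          have : (0 : ℝ) ≤ t := zero_le_one.trans (le_of_lt ht)
          positivity

/-- Convexity gives `α(g/(3a)) ≤ α(g/a)/3`, so `exp α(g/(3a)) > w` forces `α(g/a) > 3 log w`, an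
event of probability at most `2 w⁻³`. This is the source of the factor `3`. -/
lemma lintegral_tau_div_three_le (hα : IsConvexLsc α) [IsProbabilityMeasure μ] {g : X → ℝ≥0}
    (hg : Measurable g)
    (h : ∀ y : ℝ≥0, μ {x | (y : ℝ≥0∞) < α (g x / a)} ≤ ENNReal.ofReal (2 * Real.exp (-y))) :
    ∫⁻ x, tau α (g x / (3 * a)) ∂μ ≤ 1 := by
  rw [lintegral_tau_le_one_iff]
  refine lintegral_le_two_of_tail
    ((monotone_expOf hα.monotone).measurable.comp (hg.div_const _)) fun w hw => ?_
  have hw0 : 0 < w := by linarith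
  have hlog : 0 < Real.log w := Real.log_pos hw
  have hexp : w ^ (-3 : ℝ) = Real.exp (-(3 * Real.log w)) := by
    rw [Real.rpow_def_of_pos hw0]
    ring_nf
  rw [hexp]
  refine (measure_mono fun x hx => ?_).trans (h ⟨3 * Real.log w, by positivity⟩)
  have hx' : ENNReal.ofReal w < expOf α (g x / (3 * a)) := hx
  show _ < α (g x / a)
  by_contra! hle
  have h3 : α (g x / (3 * a)) ≤ (3⁻¹ : ℝ≥0) * α (g x / a) := by
    have : g x / (3 * a) = 3⁻¹ * (g x / a) := by
      rw [div_mul_eq_div_div_swap]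
      ring
    rw [this]
    exact hα.map_mul_le (inv_le_one_of_one_le₀ (by norm_num)) _
  have hne : α (g x / a) ≠ ∞ := ne_top_of_le_ne_top ENNReal.coe_ne_top hle
  have hne3 : α (g x / (3 * a)) ≠ ∞ :=
    ne_top_of_le_ne_top (ENNReal.mul_ne_top ENNReal.coe_ne_top hne) h3
  have h1 := ENNReal.toReal_mono (ENNReal.mul_ne_top ENNReal.coe_ne_top hne) h3
  have h2 : (α (g x / a)).toReal ≤ 3 * Real.log w := ENNReal.toReal_mono ENNReal.coe_ne_top hle
  rw [ENNReal.toReal_mul] at h1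
  simp only [ENNReal.coe_toReal, NNReal.coe_inv, NNReal.coe_ofNat] at h1
  rw [expOf_of_ne_top hne3, ENNReal.ofReal_lt_ofReal_iff (Real.exp_pos _),
    ← Real.log_lt_iff_lt_exp hw0] at hx'
  linarith

/-- A single point of `s` with `g x` below the weighted total variation is enough: `y < α(g x / a) ≤
H(ν|μ) = -log μ(s)` for the conditioned measure `ν`. -/
lemma measure_le_exp_neg (hα : IsConvexLsc α) [IsProbabilityMeasure μ] {χ g : X → ℝ≥0}
    (ha : 0 < a) (hP : PinskerIneq α χ μ a) {s : Set X} (hs : MeasurableSet s) {y : ℝ≥0}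
    (hy : ∀ x ∈ s, (y : ℝ≥0∞) < α (g x / a))
    (hT : ∀ (ν : Measure X) [IsProbabilityMeasure ν], ν = ProbabilityTheory.cond μ s →
      ν sᶜ = 0 → ∃ x ∈ s, (g x : ℝ≥0∞) ≤ weightedTV χ ν μ) :
    μ s ≤ ENNReal.ofReal (Real.exp (-y)) := by
  rcases eq_or_ne (μ s) 0 with h0 | h0
  · simp [h0]
  have hprob := ProbabilityTheory.cond_isProbabilityMeasure (μ := μ) h0
  have hcompl : ProbabilityTheory.cond μ s sᶜ = 0 := by
    rw [prob_compl_eq_zero_iff hs, ProbabilityTheory.cond_apply_self h0 (by simp)]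
  obtain ⟨x, hx, hxT⟩ := hT _ rfl hcompl
  have h1 : (y : ℝ≥0∞) < ENNReal.ofReal (-Real.log (μ.real s)) := by
    rw [← klDiv_cond hs h0]
    refine (hy x hx).trans_le ((le_extendTop hα.monotone ?_).trans (hP _))
    rw [ENNReal.coe_div ha.ne']
    gcongr
  have hm : 0 < μ.real s := ENNReal.toReal_pos h0 (by simp)
  rw [← ENNReal.ofReal_coe_nnreal, ENNReal.ofReal_lt_ofReal_iff_of_nonneg y.coe_nonneg] at h1
  rw [← ofReal_measureReal (s := s)]
  refine ENNReal.ofReal_le_ofReal ?_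
  rw [← Real.log_le_iff_le_exp hm]
  linarith

lemma measurableSet_tail (hα : IsConvexLsc α) {g : X → ℝ≥0} (hg : Measurable g) (y : ℝ≥0) :
    MeasurableSet {x | (y : ℝ≥0∞) < α (g x / a)} :=
  measurableSet_lt measurable_const (hα.monotone.measurable.comp (hg.div_const a))

/-- Without atoms, the weighted Pinsker inequality bounds the Luxemburg norm by `3 a`. -/
lemma luxNorm_le_of_pinskerIneq_of_noAtoms [TopologicalSpace X] [PolishSpace X] [BorelSpace X]
    (hα : IsConvexLsc α) [IsProbabilityMeasure μ] {χ : X → ℝ≥0} (hχ : Measurable χ)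
    (hint : ∫⁻ x, (χ x : ℝ≥0∞) ∂μ < ∞) (ha : 0 < a) (hP : PinskerIneq α χ μ a)
    (hμ : ∀ x, μ {x} = 0) : luxNorm α μ (fun x => (χ x : ℝ)) ≤ 3 * (a : ℝ≥0∞) := by
  obtain ⟨E, hE, hEq⟩ := exists_setLIntegral_eq_compl μ hμ χ hint.ne
  have half : ∀ F : Set X, MeasurableSet F →
      ∫⁻ x in F, χ x ∂μ = ∫⁻ x in Fᶜ, χ x ∂μ → ∀ y : ℝ≥0,
      μ (F ∩ {x | (y : ℝ≥0∞) < α (χ x / a)}) ≤ ENNReal.ofReal (Real.exp (-y)) := by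
    intro F hF hFeq y
    set s := F ∩ {x | (y : ℝ≥0∞) < α (χ x / a)} with hs
    have hsm : MeasurableSet s := hF.inter (measurableSet_tail hα hχ y)
    refine measure_le_exp_neg hα ha hP hsm (fun x hx => hx.2) fun ν _ _ hν => ?_
    -- Some point outside the `ν`-null set `sᶜ` has `χ` at most its `ν`-mean.
    obtain ⟨x, hx, hxle⟩ := exists_notMem_null_le_lintegral
      (μ := ν) (f := fun x => (χ x : ℝ≥0∞)) (hχ.coe_nnreal_ennreal).aemeasurable hν
    refine ⟨x, by simpa using hx, hxle.trans ?_⟩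
    have h1 := setLIntegral_add_compl_le_weightedTV χ ν μ hsm
    -- As `s` lies in one half, the `χ μ`-mass lost on `s` is compensated on `sᶜ`; the total
    -- variation thus dominates the whole mean `∫ χ dν`.
    have h2 : ∫⁻ x in s, χ x ∂μ ≤ ∫⁻ x in sᶜ, χ x ∂μ :=
      (lintegral_mono_set inter_subset_left).trans
        (hFeq.le.trans (lintegral_mono_set (compl_subset_compl.2 inter_subset_left)))
    have h3 : ∫⁻ x in sᶜ, χ x ∂ν = 0 := setLIntegral_measure_zero _ _ hν
    rw [← lintegral_add_compl _ hsm, h3, add_zero]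
    rw [h3, add_zero] at h1
    refine ENNReal.le_of_add_le_add_right ?_ (h1.trans (add_le_add le_rfl h2))
    exact ((setLIntegral_le_lintegral _ _).trans_lt hint).ne
  have hlux := luxNorm_le (α := α) (μ := μ) (f := fun x => (χ x : ℝ)) (l := 3 * a)
    (by positivity) ?_
  · simpa using hlux
  simp only [NNReal.nnnorm_eq]
  refine lintegral_tau_div_three_le hα hχ fun y => ?_
  calc μ {x | (y : ℝ≥0∞) < α (χ x / a)}
      ≤ μ (E ∩ {x | (y : ℝ≥0∞) < α (χ x / a)}) + μ (Eᶜ ∩ {x | (y : ℝ≥0∞) < α (χ x / a)}) := by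
        refine (measure_mono ?_).trans (measure_union_le _ _)
        rw [← union_inter_distrib_right, union_compl_self, univ_inter]
    _ ≤ ENNReal.ofReal (Real.exp (-y)) + ENNReal.ofReal (Real.exp (-y)) :=
        add_le_add (half E hE hEq y) (half Eᶜ hE.compl (by rw [compl_compl, hEq]) y)
    _ = _ := by
        rw [← ENNReal.ofReal_add (by positivity) (by positivity)]
        ring_nf

/-- The weighted Pinsker inequality bounds the Luxemburg norm of the weight. -/
lemma luxNorm_le_of_pinskerIneq (hα : IsConvexLsc α) (hA2 : AssumptionA2 α)
    [IsProbabilityMeasure μ] {χ : X → ℝ≥0} (hχ : Measurable χ)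
    (hint : ∫⁻ x, (χ x : ℝ≥0∞) ∂μ < ∞) (ha : 0 < a) (hP : PinskerIneq α χ μ a) :
    luxNorm α μ (fun x => (χ x : ℝ)) ≤
      3 * (a : ℝ≥0∞) + (∫⁻ x, (χ x : ℝ≥0∞) ∂μ) * luxNorm α μ (fun _ => (1 : ℝ)) := by
  obtain ⟨m, hm⟩ : ∃ m : ℝ≥0, ∫⁻ x, (χ x : ℝ≥0∞) ∂μ = m :=
    ⟨_, (ENNReal.coe_toNNReal hint.ne).symm⟩
  have hg : Measurable fun x => χ x - m := hχ.sub_const m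
  -- Here `∫ χ dν` is at most the total variation plus `m`, so the tail bound applies to the
  -- truncated difference `χ - m`.
  have htail : ∫⁻ x, tau α ((χ x - m) / (3 * a)) ∂μ ≤ 1 := by
    refine lintegral_tau_div_three_le hα hg fun y => ?_
    have hsm := measurableSet_tail (a := a) hα hg y
    refine (measure_le_exp_neg (g := fun x => χ x - m) hα ha hP hsm (fun x hx => hx)
      fun ν _ _ hν => ?_).trans (ENNReal.ofReal_le_ofReal ?_)
    · obtain ⟨x, hx, hxle⟩ := exists_notMem_null_le_lintegral
        (μ := ν) (f := fun x => (χ x : ℝ≥0∞)) (hχ.coe_nnreal_ennreal).aemeasurable hν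
      refine ⟨x, by simpa using hx, ?_⟩
      rw [ENNReal.coe_sub, tsub_le_iff_right, ← hm]
      exact hxle.trans (lintegral_le_weightedTV_add χ ν μ)
    · linarith [Real.exp_pos (-y)]
  rw [hm]
  -- `χ ≤ (χ - m) + m` displays `χ / (3a + m l)` as dominated by a convex combination of `(χ -
  -- m)/(3a)` and `1/l`.
  have key : ∀ l : ℝ≥0, (0 < l ∧ ∫⁻ _, tau α (‖(1 : ℝ)‖₊ / l) ∂μ ≤ 1) →
      luxNorm α μ (fun x => (χ x : ℝ)) ≤ 3 * (a : ℝ≥0∞) + m * l := by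
    rintro l ⟨hl, hle⟩
    have hlux := luxNorm_le (α := α) (μ := μ) (f := fun x => (χ x : ℝ)) (l := 3 * a + m * l)
      (by positivity) ?_
    · simpa using hlux
    have hpq : 3 * a / (3 * a + m * l) + m * l / (3 * a + m * l) = 1 := by
      rw [← add_div, div_self (by positivity)]
    simp only [NNReal.nnnorm_eq]
    simp only [nnnorm_one] at hle
    calc ∫⁻ x, tau α (χ x / (3 * a + m * l)) ∂μ
        ≤ ∫⁻ x, (3 * a / (3 * a + m * l) : ℝ≥0) * tau α ((χ x - m) / (3 * a)) +
          (m * l / (3 * a + m * l) : ℝ≥0) * tau α (1 / l) ∂μ := by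
          refine lintegral_mono fun x => ?_
          refine (monotone_tau hα.monotone ?_).trans (hα.tau_le_comb hpq _ _)
          calc χ x / (3 * a + m * l) ≤ ((χ x - m) + m) / (3 * a + m * l) := by
                gcongr
                exact le_tsub_add
            _ = _ := by field_simp
      _ ≤ (3 * a / (3 * a + m * l) : ℝ≥0) * 1 + (m * l / (3 * a + m * l) : ℝ≥0) * 1 := by
          rw [lintegral_add_right _ measurable_const, lintegral_const_mul' _ _ (by simp)]
          gcongr
          rw [lintegral_const_mul' _ _ (by simp)]
          gcongr
      _ = 1 := by
          rw [mul_one, mul_one]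
          exact_mod_cast hpq
  rcases eq_or_ne m 0 with rfl | hm0
  · obtain ⟨l, hl, -⟩ := luxNorm_lt_iff.1 (luxNorm_one_lt_top hα hA2 (μ := μ))
    simpa using key l hl
  · rw [luxNorm.eq_def α μ fun _ => (1 : ℝ), ENNReal.mul_iInf_of_ne (by simpa) (by simp), ENNReal.add_iInf]
    refine le_iInf fun l => ?_
    rw [ENNReal.mul_iInf_of_ne (by simpa) (by simp), ENNReal.add_iInf]
    exact le_iInf fun hl => key l hl

end WeightedPinsker

namespace WeightedPinsker

/-! ### The conjugate `α⊛` and its inverse. -/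

section MonConj

variable {α : ℝ≥0 → ℝ≥0∞} {s₀ c : ℝ≥0}

/-- `α⊛` grows at least linearly beyond `s₀`. Boundedness makes the `sSup` in `monConjInv` a genuine
supremum. -/
lemma SuperQuadratic.bddAbove (hs : SuperQuadratic α s₀ c) (y : ℝ≥0) :
    BddAbove {s : ℝ≥0 | monConj α s ≤ (y : ℝ≥0∞)} := by
  have hpos : 0 < c * s₀ ^ 2 := mul_pos hs.c_pos (pow_pos hs.s₀_pos 2)
  set k : ℝ≥0 := (y + 1) / (c * s₀ ^ 2) + 1 with hk
  refine ⟨k * s₀, fun s hsy => ?_⟩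
  by_contra! hlt
  have h1 : (k * (c * s₀ ^ 2) : ℝ≥0) ≤ y := by
    have : ((k * (c * s₀ ^ 2) : ℝ≥0) : ℝ≥0∞) ≤ y := by
      rw [ENNReal.coe_mul]
      calc (k : ℝ≥0∞) * ((c * s₀ ^ 2 : ℝ≥0) : ℝ≥0∞) ≤ k * monConj α s₀ := by
            gcongr
            exact hs.le s₀ le_rfl
        _ ≤ monConj α (k * s₀) := mul_monConj_le α le_add_self s₀
        _ ≤ monConj α s := monotone_monConj α hlt.le
        _ ≤ y := hsy
    exact_mod_cast this
  have h2 : y < k * (c * s₀ ^ 2) := by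
    rw [hk, add_mul, div_mul_cancel₀ _ hpos.ne', one_mul]
    calc y < y + 1 := lt_add_one y
      _ ≤ _ := le_self_add
  exact absurd h1 h2.not_ge

lemma AssumptionA1.exists_pos (hA1 : AssumptionA1 α) :
    ∃ s : ℝ≥0, 0 < s ∧ monConj α s ≠ ∞ := by
  obtain ⟨b, hb, hdom⟩ := hA1
  obtain ⟨s, hs0, hsb⟩ := ENNReal.lt_iff_exists_nnreal_btwn.1 hb
  have : s ∈ effDom (monConj α) := by
    rw [hdom]
    exact hsb
  exact ⟨s, by exact_mod_cast hs0, this.ne⟩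

lemma monConjInv_pos (hA1 : AssumptionA1 α) (hs : SuperQuadratic α s₀ c) {y : ℝ≥0}
    (hy : 0 < y) : 0 < monConjInv α y := by
  obtain ⟨s, hs0, hfin⟩ := hA1.exists_pos
  obtain ⟨z, hz⟩ : ∃ z : ℝ≥0, monConj α s = z := ⟨_, (ENNReal.coe_toNNReal hfin).symm⟩
  set k : ℝ≥0 := z / y + 1
  have hk : 0 < k := by positivity
  have hmem : s / k ∈ {s : ℝ≥0 | monConj α s ≤ (y : ℝ≥0∞)} := by
    have h1 := mul_monConj_le α (le_add_self : 1 ≤ k) (s / k)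
    rw [mul_div_cancel₀ _ hk.ne', hz] at h1
    show monConj α (s / k) ≤ y
    have h2 : (z : ℝ≥0∞) ≤ k * y := by
      have : z ≤ k * y := by
        rw [add_mul, div_mul_cancel₀ _ hy.ne']
        exact le_self_add
      exact_mod_cast this
    exact (ENNReal.mul_le_mul_iff_right (by simp) (by simp)).1 (h1.trans h2)
  exact lt_of_lt_of_le (by positivity) (le_csSup (hs.bddAbove y) hmem)

/-- Each inequality `s t ≤ α t + y` is closed in `s`, hence survives at the supremum. -/
lemma monConj_monConjInv_le (α : ℝ≥0 → ℝ≥0∞) (y : ℝ≥0) :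
    monConj α (monConjInv α y) ≤ y := by
  refine iSup_le fun t => ?_
  rw [tsub_le_iff_right]
  rcases eq_or_ne t 0 with rfl | ht
  · simp
  by_cases htop : α t = ∞
  · simp [htop]
  lift α t to ℝ≥0 using htop with z hz
  norm_cast
  rw [← le_div_iff₀ (pos_iff_ne_zero.2 ht)]
  by_cases hne : {s : ℝ≥0 | monConj α s ≤ (y : ℝ≥0∞)}.Nonempty
  · refine csSup_le hne fun s hs => ?_
    rw [le_div_iff₀ (pos_iff_ne_zero.2 ht)]
    have h1 := (young_le α s t).trans (add_le_add le_rfl hs)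
    rw [← hz, add_comm] at h1
    exact_mod_cast h1
  · rw [monConjInv, not_nonempty_iff_eq_empty.1 hne]
    simp

lemma lt_monConj (hs : SuperQuadratic α s₀ c) {y s : ℝ≥0} (h : monConjInv α y < s) :
    y < monConj α s := by
  by_contra! hle
  exact absurd (le_csSup (hs.bddAbove y) hle) h.not_ge

end MonConj

/-! ### Elementary exponential inequalities. -/

section Calculus

lemma exp_le_quadratic {x y : ℝ} (hxy : |x| ≤ y) :
    Real.exp x ≤ 1 + x + y ^ 2 * Real.exp y := by
  have h1 : Real.exp x ≤ 1 + x * Real.exp x := by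
    have := mul_le_mul_of_nonneg_right (Real.add_one_le_exp (-x)) (Real.exp_pos x).le
    rw [← Real.exp_add, neg_add_cancel, Real.exp_zero] at this
    linarith
  have hy : 0 ≤ y := (abs_nonneg x).trans hxy
  have h2 : x * (Real.exp x - 1) ≤ y ^ 2 * Real.exp y := by
    rcases le_total 0 x with hx | hx
    · rw [abs_of_nonneg hx] at hxy
      calc x * (Real.exp x - 1) ≤ x * (x * Real.exp x) := by gcongr; linarith
        _ ≤ y * (y * Real.exp y) := by gcongr
        _ = _ := by ring
    · rw [abs_of_nonpos hx] at hxy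
      calc x * (Real.exp x - 1) = (-x) * (1 - Real.exp x) := by ring
        _ ≤ (-x) * (-x) := by
          gcongr
          · linarith
          · linarith [Real.add_one_le_exp x]
        _ ≤ y * y := by
          gcongr
          linarith
        _ ≤ y ^ 2 * Real.exp y := by
          rw [← pow_two]
          exact le_mul_of_one_le_right (by positivity) (Real.one_le_exp hy)
  linarith

/-- The constant is the maximum of `y² exp(-3y/4)`, attained at `y = 8/3`; it follows by squaring `e
z ≤ exp z` at `z = 3y/8`. -/
lemma sq_mul_exp_le {y : ℝ} (hy : 0 ≤ y) :
    y ^ 2 * Real.exp (y / 4) ≤ 64 / (9 * Real.exp 2) * Real.exp y := by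
  have h1 : 3 * y / 8 * Real.exp 1 ≤ Real.exp (3 * y / 8) := by
    have := Real.add_one_le_exp (3 * y / 8 - 1)
    rw [Real.exp_sub, le_div_iff₀ (Real.exp_pos 1)] at this
    linarith
  have h2 : (3 * y / 8 * Real.exp 1) ^ 2 ≤ Real.exp (3 * y / 8) ^ 2 := by gcongr
  rw [mul_pow, ← Real.exp_nat_mul, ← Real.exp_nat_mul] at h2
  have e1 : ((2 : ℕ) : ℝ) * 1 = 2 := by norm_num
  rw [e1] at h2
  have h3 : Real.exp y = Real.exp (((2 : ℕ) : ℝ) * (3 * y / 8)) * Real.exp (y / 4) := by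
    rw [← Real.exp_add]
    congr 1
    push_cast
    ring
  rw [h3, ← mul_assoc]
  gcongr
  rw [div_mul_eq_mul_div, le_div_iff₀ (by positivity)]
  nlinarith

open InformationTheory in
-- Young's inequality for the conjugate pair `klFun` and `exp - 1`.
lemma mul_le_klFun_add {p : ℝ} (hp : 0 ≤ p) (z : ℝ) :
    p * z ≤ klFun p + (Real.exp z - 1) := by
  rw [klFun_apply]
  rcases hp.eq_or_lt with rfl | hp
  · simp [(Real.exp_pos z).le]
  · have h := mul_le_mul_of_nonneg_left (Real.add_one_le_exp (z - Real.log p)) hp.le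
    rw [Real.exp_sub, Real.exp_log hp, mul_div_cancel₀ _ hp.ne'] at h
    linarith

end Calculus

/-! ### The variational inequality for relative entropy. -/

section DonskerVaradhan

open InformationTheory

variable {X : Type*} [MeasurableSpace X] {μ ν : Measure X} [IsProbabilityMeasure μ]
  [IsProbabilityMeasure ν] {g : X → ℝ}

lemma integrable_of_integrable_exp_abs (hH : klDiv ν μ ≠ ∞) (hg : Measurable g)
    (hexp : Integrable (fun x => Real.exp |g x|) μ) : Integrable g ν := by
  obtain ⟨hac, hllr⟩ := klDiv_ne_top_iff.1 hH
  rw [← integrable_rnDeriv_smul_iff hac]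
  refine (((integrable_klFun_rnDeriv_iff hac).2 hllr).add hexp).mono'
    ((ν.measurable_rnDeriv μ).ennreal_toReal.smul hg).aestronglyMeasurable
    (.of_forall fun x => ?_)
  have := mul_le_klFun_add (ENNReal.toReal_nonneg (a := ν.rnDeriv μ x)) |g x|
  simp only [smul_eq_mul, norm_mul, Real.norm_eq_abs, Pi.add_apply, abs_of_nonneg,
    ENNReal.toReal_nonneg]
  linarith

/-- The variational inequality `∫ g dν ≤ H(ν | μ) + log ∫ exp g dμ`. -/
lemma integral_le_klDiv_add (hH : klDiv ν μ ≠ ∞) (hg : Measurable g)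
    (hexp : Integrable (fun x => Real.exp |g x|) μ) {L : ℝ}
    (hL : ∫ x, Real.exp (g x) ∂μ ≤ Real.exp L) : ∫ x, g x ∂ν ≤ (klDiv ν μ).toReal + L := by
  obtain ⟨hac, hllr⟩ := klDiv_ne_top_iff.1 hH
  have hgν := integrable_of_integrable_exp_abs hH hg hexp
  have hkl := (integrable_klFun_rnDeriv_iff hac).2 hllr
  have hexp' : Integrable (fun x => Real.exp (g x)) μ := by
    refine hexp.mono' hg.exp.aestronglyMeasurable (.of_forall fun x => ?_)
    rw [Real.norm_eq_abs, Real.abs_exp]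
    exact Real.exp_le_exp.2 (le_abs_self _)
  have hgL : Integrable (fun x => g x - L) ν := hgν.sub (integrable_const L)
  have hsub : Integrable (fun x => Real.exp (g x) / Real.exp L - 1) μ :=
    (hexp'.div_const _).sub (integrable_const 1)
  -- Applying Young's inequality to `g - L` makes the term `∫ (exp(g - L) - 1) dμ` nonpositive.
  have h1 : ∫ x, (g x - L) ∂ν ≤
      ∫ x, (klFun (ν.rnDeriv μ x).toReal + (Real.exp (g x) / Real.exp L - 1)) ∂μ := by
    rw [← integral_rnDeriv_smul hac]
    refine integral_mono ((integrable_rnDeriv_smul_iff hac).2 hgL)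
      (hkl.add hsub) fun x => ?_
    have := mul_le_klFun_add (ENNReal.toReal_nonneg (a := ν.rnDeriv μ x)) (g x - L)
    rwa [Real.exp_sub] at this
  rw [integral_sub hgν (integrable_const L),
    integral_add hkl hsub,
    integral_sub (hexp'.div_const _) (integrable_const 1), integral_div,
    ← toReal_klDiv_eq_integral_klFun hac] at h1
  have h2 : (∫ x, Real.exp (g x) ∂μ) / Real.exp L ≤ 1 := div_le_one_of_le₀ hL (Real.exp_pos L).le
  simp at h1
  linarith

end DonskerVaradhan

end WeightedPinsker

/-! ### Laplace transforms of functions dominated by the weight. -/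

namespace WeightedPinsker

variable {α : ℝ≥0 → ℝ≥0∞} {X : Type*} [MeasurableSpace X] {μ : Measure X}
  {χ : X → ℝ≥0} {s₀ c : ℝ≥0} {u a : ℝ}

lemma exp_mul_le_expOf {s : ℝ≥0} (hs : monConj α s ≠ ∞) (t : ℝ≥0) :
    ENNReal.ofReal (Real.exp (s * t)) ≤
      ENNReal.ofReal (Real.exp (monConj α s).toReal) * expOf α t := by
  by_cases htop : α t = ∞
  · rw [expOf_of_eq_top htop, ENNReal.mul_top (by simp [Real.exp_pos])]
    exact le_top
  · rw [expOf_of_ne_top htop, ← ENNReal.ofReal_mul (Real.exp_pos _).le, ← Real.exp_add]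
    refine ENNReal.ofReal_le_ofReal (Real.exp_le_exp.2 ?_)
    have := ENNReal.toReal_mono (ENNReal.add_ne_top.2 ⟨htop, hs⟩) (young_le α s t)
    rw [ENNReal.toReal_add htop hs, ENNReal.toReal_mul] at this
    simp only [ENNReal.coe_toReal] at this
    linarith

lemma lintegral_exp_mul_le (hE : ∫⁻ x, expOf α (χ x) ∂μ ≤ 2) {s : ℝ≥0} (hs : monConj α s ≠ ∞) :
    ∫⁻ x, ENNReal.ofReal (Real.exp (s * χ x)) ∂μ ≤
      ENNReal.ofReal (2 * Real.exp (monConj α s).toReal) := by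
  calc ∫⁻ x, ENNReal.ofReal (Real.exp (s * χ x)) ∂μ
      ≤ ∫⁻ x, ENNReal.ofReal (Real.exp (monConj α s).toReal) * expOf α (χ x) ∂μ :=
        lintegral_mono fun x => exp_mul_le_expOf hs (χ x)
    _ ≤ ENNReal.ofReal (Real.exp (monConj α s).toReal) * 2 := by
        rw [lintegral_const_mul' _ _ (by simp)]
        gcongr
    _ = _ := by
        rw [mul_comm, ENNReal.ofReal_mul (by norm_num)]
        simp

lemma integrable_exp_mul (hχ : Measurable χ) (hE : ∫⁻ x, expOf α (χ x) ∂μ ≤ 2) {s : ℝ≥0}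
    (hs : monConj α s ≠ ∞) : Integrable (fun x => Real.exp (s * χ x)) μ := by
  refine ⟨(hχ.coe_nnreal_real.const_mul _).exp.aestronglyMeasurable, ?_⟩
  rw [hasFiniteIntegral_iff_ofReal (.of_forall fun x => (Real.exp_pos _).le)]
  exact (lintegral_exp_mul_le hE hs).trans_lt ENNReal.ofReal_lt_top

lemma integral_exp_mul_le (hχ : Measurable χ) (hE : ∫⁻ x, expOf α (χ x) ∂μ ≤ 2) {s : ℝ≥0}
    (hs : monConj α s ≠ ∞) :
    ∫ x, Real.exp (s * χ x) ∂μ ≤ 2 * Real.exp (monConj α s).toReal := by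
  rw [integral_eq_lintegral_of_nonneg_ae (.of_forall fun x => (Real.exp_pos _).le)
    (hχ.coe_nnreal_real.const_mul _).exp.aestronglyMeasurable]
  exact ENNReal.toReal_le_of_le_ofReal (by positivity) (lintegral_exp_mul_le hE hs)

lemma toReal_mul_le_monConj {k s : ℝ≥0} (hk : 1 ≤ k) (h : monConj α (k * s) ≠ ∞) :
    monConj α s ≠ ∞ ∧ k * (monConj α s).toReal ≤ (monConj α (k * s)).toReal := by
  have h1 := mul_monConj_le α hk s
  refine ⟨ne_top_of_le_ne_top h (monotone_monConj α (le_mul_of_one_le_left zero_le hk)), ?_⟩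
  simpa using ENNReal.toReal_mono h h1

section LogLaplace

variable {φ : X → ℝ} {s : ℝ≥0}

lemma integrable_of_abs_le (hint : ∫⁻ x, (χ x : ℝ≥0∞) ∂μ < ∞) (hχ : Measurable χ)
    (hφ : Measurable φ) (hle : ∀ x, |φ x| ≤ χ x) : Integrable φ μ := by
  have : Integrable (fun x => (χ x : ℝ)) μ := by
    refine ⟨hχ.coe_nnreal_real.aestronglyMeasurable, ?_⟩
    rw [hasFiniteIntegral_iff_ofReal (.of_forall fun x => (χ x).coe_nonneg)]
    simpa using hint
  exact this.mono' hφ.aestronglyMeasurable (.of_forall hle)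

lemma integrable_exp_of_abs_le (hχ : Measurable χ) (hE : ∫⁻ x, expOf α (χ x) ∂μ ≤ 2)
    (hs : monConj α s ≠ ∞) (hφ : Measurable φ) (hle : ∀ x, |φ x| ≤ χ x) :
    Integrable (fun x => Real.exp (s * φ x)) μ := by
  refine (integrable_exp_mul hχ hE hs).mono' (hφ.const_mul _).exp.aestronglyMeasurable
    (.of_forall fun x => ?_)
  rw [Real.norm_eq_abs, Real.abs_exp, Real.exp_le_exp]
  exact mul_le_mul_of_nonneg_left ((le_abs_self _).trans (hle x)) s.coe_nonneg

variable [IsProbabilityMeasure μ]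

/-- The Laplace transform bound for small parameters. -/
lemma integral_exp_le_of_le (hχ : Measurable χ) (hint : ∫⁻ x, (χ x : ℝ≥0∞) ∂μ < ∞)
    (hE : ∫⁻ x, expOf α (χ x) ∂μ ≤ 2) (hφ : Measurable φ) (hle : ∀ x, |φ x| ≤ χ x)
    {σ : ℝ≥0} (hσ : 0 < σ) (hσ2 : monConj α σ ≤ 2) (hsσ : s ≤ σ / 4) :
    ∫ x, Real.exp (s * φ x) ∂μ ≤ Real.exp (s * ∫ x, φ x ∂μ + 16 * (s / σ) ^ 2) := by
  have hσtop : monConj α σ ≠ ∞ := ne_top_of_le_ne_top (by simp) hσ2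
  have hσr : (0 : ℝ) < σ := by exact_mod_cast hσ
  have hsσr : (s : ℝ) ≤ σ / 4 := by exact_mod_cast hsσ
  have hsfin : monConj α s ≠ ∞ := by
    refine ne_top_of_le_ne_top hσtop (monotone_monConj α (hsσ.trans ?_))
    exact div_le_self zero_le (by norm_num)
  have hφint := integrable_of_abs_le hint hχ hφ hle
  have hEσ := integrable_exp_mul hχ hE hσtop
  set K : ℝ := (s / σ) ^ 2 * (64 / (9 * Real.exp 2)) with hK
  -- Because `s ≤ σ/4`, the remainder `(sχ)² exp(sχ)` is at most `(s/σ)² (σχ)² exp(σχ/4)`, which is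
  -- controlled by `exp(σχ)`.
  have hpt : ∀ x, Real.exp (s * φ x) ≤ 1 + s * φ x + K * Real.exp (σ * χ x) := by
    intro x
    have hx : |s * φ x| ≤ s * χ x := by
      rw [abs_mul, abs_of_nonneg s.coe_nonneg]
      exact mul_le_mul_of_nonneg_left (hle x) s.coe_nonneg
    refine (exp_le_quadratic hx).trans (add_le_add le_rfl ?_)
    have hy : (0 : ℝ) ≤ σ * χ x := by positivity
    calc (s * χ x : ℝ) ^ 2 * Real.exp (s * χ x)
        ≤ (s * χ x : ℝ) ^ 2 * Real.exp (σ * χ x / 4) := by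
          gcongr
          nlinarith [(χ x).coe_nonneg]
      _ = (s / σ : ℝ) ^ 2 * ((σ * χ x) ^ 2 * Real.exp (σ * χ x / 4)) := by
          field_simp
      _ ≤ (s / σ : ℝ) ^ 2 * (64 / (9 * Real.exp 2) * Real.exp (σ * χ x)) := by
          exact mul_le_mul_of_nonneg_left (sq_mul_exp_le hy) (by positivity)
      _ = _ := by rw [hK]; ring
  have h1 : ∫ x, Real.exp (s * φ x) ∂μ ≤
      1 + s * ∫ x, φ x ∂μ + K * ∫ x, Real.exp (σ * χ x) ∂μ := by
    have hK' : Integrable (fun x => K * Real.exp (σ * χ x)) μ := hEσ.const_mul K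
    have hlin : Integrable (fun x => 1 + s * φ x) μ :=
      (integrable_const 1).add (hφint.const_mul _)
    refine (integral_mono (g := fun x => 1 + s * φ x + K * Real.exp (σ * χ x))
      (integrable_exp_of_abs_le hχ hE hsfin hφ hle) (hlin.add hK') hpt).trans_eq ?_
    rw [integral_add hlin hK', integral_add (integrable_const 1)
      (hφint.const_mul _), integral_const_mul, integral_const_mul]
    simp
  -- `∫ exp(σχ) dμ ≤ 2 e²` as `α⊛ σ ≤ 2`, so the `e²` in `K` cancels and `128/9 ≤ 16` remains.
  have h2 : K * ∫ x, Real.exp (σ * χ x) ∂μ ≤ 16 * (s / σ) ^ 2 := by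
    have hσ2' : (monConj α σ).toReal ≤ 2 := by
      simpa using ENNReal.toReal_mono (by simp) hσ2
    calc K * ∫ x, Real.exp (σ * χ x) ∂μ ≤ K * (2 * Real.exp 2) := by
          gcongr
          exact (integral_exp_mul_le hχ hE hσtop).trans (by gcongr)
      _ = 128 / 9 * (s / σ : ℝ) ^ 2 := by
          rw [hK]
          field_simp
          ring
      _ ≤ _ := by gcongr; norm_num
  refine h1.trans ((Real.add_one_le_exp _).trans' ?_)
  linarith

/-- The Laplace transform bound for large values of the conjugate. -/
lemma integral_exp_le_of_three_le (hχ : Measurable χ) (hint : ∫⁻ x, (χ x : ℝ≥0∞) ∂μ < ∞)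
    (hE : ∫⁻ x, expOf α (χ x) ∂μ ≤ 2) (hφ : Measurable φ) (hle : ∀ x, |φ x| ≤ χ x)
    (hs : monConj α s ≠ ∞) {B : ℝ} (hB : 3 ≤ B) (hsB : 4 * (monConj α s).toReal ≤ B) :
    ∫ x, Real.exp (s * φ x) ∂μ ≤ Real.exp (s * ∫ x, φ x ∂μ + B) := by
  have hlog2 : Real.log 2 < 0.7 := Real.log_two_lt_d9.trans (by norm_num)
  have hφint := integrable_of_abs_le hint hχ hφ hle
  have hχint : Integrable (fun x => (χ x : ℝ)) μ :=
    integrable_of_abs_le hint hχ hχ.coe_nnreal_real fun x => by simp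
  have hEs := integrable_exp_mul hχ hE hs
  have hbound : ∫ x, Real.exp (s * χ x) ∂μ ≤ Real.exp (Real.log 2 + (monConj α s).toReal) := by
    rw [Real.exp_add, Real.exp_log (by norm_num)]
    exact integral_exp_mul_le hχ hE hs
  have hjensen : s * ∫ x, (χ x : ℝ) ∂μ ≤ Real.log 2 + (monConj α s).toReal := by
    rw [← Real.exp_le_exp, ← integral_const_mul]
    refine le_trans ?_ hbound
    exact convexOn_exp.map_integral_le Real.continuous_exp.continuousOn isClosed_univ
      (by simp) (hχint.const_mul _) hEs
  have hlower : -(∫ x, (χ x : ℝ) ∂μ) ≤ ∫ x, φ x ∂μ := by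
    rw [← integral_neg]
    exact integral_mono hχint.neg hφint fun x => (abs_le.1 (hle x)).1
  have hlower' := mul_le_mul_of_nonneg_left hlower s.coe_nonneg
  calc ∫ x, Real.exp (s * φ x) ∂μ ≤ ∫ x, Real.exp (s * χ x) ∂μ := by
        refine integral_mono (integrable_exp_of_abs_le hχ hE hs hφ hle) hEs fun x => ?_
        simp only [Real.exp_le_exp]
        exact mul_le_mul_of_nonneg_left ((le_abs_self _).trans (hle x)) s.coe_nonneg
    _ ≤ _ := hbound
    -- The loss is twice `log 2 + α⊛ s`, at most `1.4 + B/2`, which is below `B` once `B ≥ 3`.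
    _ ≤ _ := by
        rw [Real.exp_le_exp]
        linarith

lemma mConst_pos (α : ℝ≥0 → ℝ≥0∞) (c : ℝ≥0) (hu : 0 < u) : 0 < mConst α c u :=
  mul_pos (Real.exp_pos 1) (lt_max_of_lt_right (by positivity))

/-- The centred Laplace transform of `φ` is controlled by the conjugate of `α`. -/
lemma integral_exp_le_monConj (hA1 : AssumptionA1 α) (hQ : SuperQuadratic α s₀ c)
    (hU : AdmissibleU s₀ c u) (hχ : Measurable χ) (hint : ∫⁻ x, (χ x : ℝ≥0∞) ∂μ < ∞)
    (hE : ∫⁻ x, expOf α (χ x) ∂μ ≤ 2) (hφ : Measurable φ) (hle : ∀ x, |φ x| ≤ χ x)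
    {a : ℝ≥0} (ha : 2 * Real.sqrt 2 * mConst α c u ≤ a) (hs : monConj α (a * s) ≠ ∞) :
    ∫ x, Real.exp (s * φ x) ∂μ ≤
      Real.exp (s * ∫ x, φ x ∂μ + (monConj α (a * s)).toReal) := by
  have hu0 := hU.pos
  have hu1 : 0 < 1 - u := sub_pos.2 hU.lt_one
  have hc : (0 : ℝ) < c := by exact_mod_cast hQ.c_pos
  set σ := monConjInv α 2 with hσdef
  have hσ : 0 < σ := monConjInv_pos hA1 hQ two_pos
  have hσr : (0 : ℝ) < σ := by exact_mod_cast hσ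
  have hσ2 : monConj α σ ≤ 2 := monConj_monConjInv_le α 2
  set q := Real.sqrt (c * (1 - u)) with hq
  have hq0 : 0 < q := Real.sqrt_pos.2 (by positivity)
  have hqsq : q ^ 2 = c * (1 - u) := Real.sq_sqrt (by positivity)
  have he : 7.6 ≤ 2 * Real.sqrt 2 * Real.exp 1 := by
    have h1 : (1.41 : ℝ) ≤ Real.sqrt 2 := Real.le_sqrt_of_sq_le (by norm_num)
    have h2 := Real.exp_one_gt_d9
    nlinarith
  have hmax : 7.6 * max (1 / (σ * q)) (1 / u) ≤ a := by
    refine le_trans ?_ ha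
    rw [mConst, ← mul_assoc]
    gcongr
  have ha1 : 7.6 / (σ * q) ≤ a := by
    rw [div_eq_mul_one_div]
    exact (mul_le_mul_of_nonneg_left (le_max_left _ _) (by norm_num)).trans hmax
  have ha2 : 7.6 / u ≤ a := by
    rw [div_eq_mul_one_div]
    exact (mul_le_mul_of_nonneg_left (le_max_right _ _) (by norm_num)).trans hmax
  have ha4 : (4 : ℝ) ≤ a := by
    refine le_trans ?_ ha2
    rw [le_div_iff₀ hu0]
    linarith [hU.lt_one]
  have ha4' : (4 : ℝ≥0) ≤ a := by exact_mod_cast ha4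
  -- The threshold is chosen so that `v = 4s/(σq)` below satisfies `v ≤ u/q ≤ s₀`, the first
  -- condition on `u`.
  rcases le_or_gt (s : ℝ) (u * σ / 4) with hsmall | hlarge
  · have hsσ : s ≤ σ / 4 := by
      rw [← NNReal.coe_le_coe]
      push_cast
      refine hsmall.trans ?_
      gcongr
      exact mul_le_of_le_one_left hσr.le hU.lt_one.le
    refine (integral_exp_le_of_le hχ hint hE hφ hle hσ hσ2 hsσ).trans ?_
    gcongr
    set v : ℝ≥0 := ⟨4 / (σ * q) * s, by positivity⟩ with hv
    have hvr : (v : ℝ) = 4 / (σ * q) * s := rfl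
    have hva : v ≤ a * s := by
      rw [← NNReal.coe_le_coe, hvr]
      push_cast
      gcongr
      refine le_trans ?_ ha1
      gcongr
      norm_num
    have hvs : v ≤ s₀ := by
      rw [← NNReal.coe_le_coe, hvr]
      have h1 := hU.le₁
      rw [div_le_iff₀ (Real.sqrt_pos.2 hu1), mul_assoc, ← Real.sqrt_mul hc.le, ← hq] at h1
      rw [div_mul_eq_mul_div, div_le_iff₀ (by positivity)]
      nlinarith
    have h2 := ENNReal.toReal_mono hs ((hQ.le v hvs).trans (monotone_monConj α hva))
    rw [ENNReal.coe_toReal] at h2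
    push_cast at h2
    rw [hvr] at h2
    refine le_trans ?_ h2
    have h3 : (c : ℝ) * (4 / (σ * q) * s) ^ 2 = 16 * (s / σ) ^ 2 * (c / q ^ 2) := by
      field_simp
      ring
    rw [h3, hqsq]
    refine le_mul_of_one_le_right (by positivity) ?_
    rw [one_le_div (by positivity)]
    exact mul_le_of_le_one_right hc.le (by linarith)
  · obtain ⟨hsfin, hks⟩ := toReal_mul_le_monConj (le_trans (by norm_num) ha4') hs
    have hB : 3 ≤ (monConj α (a * s)).toReal := by
      -- Now `a s > 7.6 σ/4 = 1.9 σ`, so `w > σ`, hence `α⊛ w > 2` and `α⊛(a s) ≥ (3/2) · 2 = 3`.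
      set w : ℝ≥0 := a * s / (3 / 2) with hw
      have hσw : σ < w := by
        rw [hw, lt_div_iff₀ (by norm_num), ← NNReal.coe_lt_coe]
        push_cast
        have h1 : 7.6 ≤ a * u := (div_le_iff₀ hu0).1 ha2
        have h2 : (a : ℝ) * (u * σ / 4) ≤ a * s := by gcongr
        nlinarith
      have haw : a * s = 3 / 2 * w := by
        rw [hw, mul_div_cancel₀ _ (by norm_num)]
      rw [haw] at hs ⊢
      have h32 : (1 : ℝ≥0) ≤ 3 / 2 := by
        rw [le_div_iff₀ (by norm_num)]
        norm_num
      obtain ⟨hwtop, hw2⟩ := toReal_mul_le_monConj h32 hs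
      refine le_trans ?_ hw2
      have h3 : (2 : ℝ) ≤ (monConj α w).toReal := by
        simpa using ENNReal.toReal_mono hwtop (lt_monConj hQ hσw).le
      push_cast
      linarith
    refine integral_exp_le_of_three_le hχ hint hE hφ hle hsfin hB (le_trans ?_ hks)
    gcongr

end LogLaplace

end WeightedPinsker

/-! ### From Laplace bounds to the inequality with its constant. -/

namespace WeightedPinsker

variable {α : ℝ≥0 → ℝ≥0∞} {X : Type*} [MeasurableSpace X] {μ : Measure X}
  {χ : X → ℝ≥0} {s₀ c : ℝ≥0} {u : ℝ} {a : ℝ≥0}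

lemma extendTop_of_ne_top {x : ℝ≥0∞} (hx : x ≠ ∞) : extendTop α x = α x.toNNReal := by
  simp [extendTop, hx]

open InformationTheory in
/-- The weighted Pinsker inequality for a normalized weight. -/
lemma pinskerIneq_of_lintegral_expOf_le (hα : IsConvexLsc α) (hA1 : AssumptionA1 α)
    (hQ : SuperQuadratic α s₀ c) (hU : AdmissibleU s₀ c u) [IsProbabilityMeasure μ]
    (hχ : Measurable χ) (hint : ∫⁻ x, (χ x : ℝ≥0∞) ∂μ < ∞)
    (hE : ∫⁻ x, expOf α (χ x) ∂μ ≤ 2) (ha : 2 * Real.sqrt 2 * mConst α c u ≤ a) :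
    PinskerIneq α χ μ a := by
  intro ν _
  rcases eq_or_ne (klDiv ν μ) ∞ with hH | hH
  · rw [hH]
    exact le_top
  have hapos : 0 < a := by
    have := mConst_pos α c hU.pos
    have : (0 : ℝ) < a := lt_of_lt_of_le (by positivity) ha
    exact_mod_cast this
  have hχμ : Integrable (fun x => (χ x : ℝ)) μ :=
    integrable_of_abs_le hint hχ hχ.coe_nnreal_real fun x => by simp
  -- Finite entropy together with exponential moments under `μ` makes `χ` integrable for `ν`, so the
  -- weighted total variation is finite.
  have hχν : Integrable (fun x => (χ x : ℝ)) ν := by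
    obtain ⟨s, hs0, hs⟩ := hA1.exists_pos
    have hg : Measurable fun x => (s : ℝ) * χ x := hχ.coe_nnreal_real.const_mul _
    have h := integrable_of_integrable_exp_abs hH hg (by
      simpa [abs_of_nonneg, mul_nonneg] using integrable_exp_mul hχ hE hs)
    have hs0' : (s : ℝ) ≠ 0 := by exact_mod_cast hs0.ne'
    simpa [hs0'] using h.const_mul (s : ℝ)⁻¹
  obtain ⟨P, hP, hPeq⟩ := exists_weightedTV_eq χ ν μ
  have hset : ∀ (m : Measure X) (t : Set X), Integrable (fun x => (χ x : ℝ)) m →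
      ∫⁻ x in t, χ x ∂m = ENNReal.ofReal (∫ x in t, (χ x : ℝ) ∂m) := by
    intro m t hm
    rw [ofReal_integral_eq_lintegral_ofReal hm.integrableOn (.of_forall fun x => (χ x).coe_nonneg)]
    simp
  have hnn : ∀ (m : Measure X) (t : Set X), 0 ≤ ∫ x in t, (χ x : ℝ) ∂m := fun m t =>
    integral_nonneg fun x => (χ x).coe_nonneg
  rw [hset _ _ hχμ, hset _ _ hχμ, hset _ _ hχν, hset _ _ hχν,
    ← ENNReal.ofReal_add (hnn _ _) (hnn _ _), ← ENNReal.ofReal_add (hnn _ _) (hnn _ _)] at hPeq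
  have hTfin : weightedTV χ ν μ ≠ ∞ :=
    ne_top_of_le_ne_top ENNReal.ofReal_ne_top (le_self_add.trans hPeq.le)
  obtain ⟨T, hT⟩ : ∃ T : ℝ≥0, weightedTV χ ν μ = T := ⟨_, (ENNReal.coe_toNNReal hTfin).symm⟩
  have hTreal : (T : ℝ) + (∫ x in P, (χ x : ℝ) ∂μ + ∫ x in Pᶜ, (χ x : ℝ) ∂ν) =
      ∫ x in P, (χ x : ℝ) ∂ν + ∫ x in Pᶜ, (χ x : ℝ) ∂μ := by
    have := congrArg ENNReal.toReal hPeq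
    rw [hT, ENNReal.toReal_add (by simp) (by simp), ENNReal.coe_toReal,
      ENNReal.toReal_ofReal (add_nonneg (hnn _ _) (hnn _ _)),
      ENNReal.toReal_ofReal (add_nonneg (hnn _ _) (hnn _ _))] at this
    exact this
  set φ : X → ℝ := fun x => P.indicator (fun x => (χ x : ℝ)) x -
    Pᶜ.indicator (fun x => (χ x : ℝ)) x with hφdef
  have hφ : Measurable φ :=
    (hχ.coe_nnreal_real.indicator hP).sub (hχ.coe_nnreal_real.indicator hP.compl)
  have hle : ∀ x, |φ x| ≤ χ x := by
    intro x
    by_cases hx : x ∈ P <;> simp [hφdef, hx]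
  have hφint : ∀ m : Measure X, Integrable (fun x => (χ x : ℝ)) m →
      ∫ x, φ x ∂m = ∫ x in P, (χ x : ℝ) ∂m - ∫ x in Pᶜ, (χ x : ℝ) ∂m := by
    intro m hm
    rw [integral_sub (hm.indicator hP) (hm.indicator hP.compl), integral_indicator hP,
      integral_indicator hP.compl]
  have hTφ : (T : ℝ) = ∫ x, φ x ∂ν - ∫ x, φ x ∂μ := by
    rw [hφint ν hχν, hφint μ hχμ]
    linarith
  have hdiv : (T : ℝ≥0∞) / a = (T / a : ℝ≥0) := (ENNReal.coe_div hapos.ne').symm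
  rw [hT, hdiv, extendTop_of_ne_top ENNReal.coe_ne_top, ENNReal.toNNReal_coe]
  refine hα.le_of_forall_mul_le fun s' hs' => ?_
  -- The dual variable is `a s`, which cancels the `a` in `T/a` and matches the Laplace bound at
  -- `s`.
  obtain ⟨s, rfl⟩ : ∃ s, s' = a * s := ⟨s' / a, (mul_div_cancel₀ _ hapos.ne').symm⟩
  have ha1 : 1 ≤ a := by
    have h1 : 1 ≤ Real.exp 1 := Real.one_le_exp zero_le_one
    have h2 : 1 ≤ Real.sqrt 2 := Real.one_le_sqrt.2 (by norm_num)
    have h3 : 1 ≤ 1 / u := (one_le_div hU.pos).2 hU.lt_one.le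
    have h4 : 1 ≤ mConst α c u :=
      one_le_mul_of_one_le_of_one_le h1 (h3.trans (le_max_right _ _))
    have : (1 : ℝ) ≤ a := le_trans (by nlinarith) ha
    exact_mod_cast this
  have hsfin := (toReal_mul_le_monConj ha1 hs').1
  have hexp : Integrable (fun x => Real.exp |s * φ x|) μ := by
    refine (integrable_exp_mul hχ hE hsfin).mono' ((hφ.const_mul _).abs).exp.aestronglyMeasurable
      (.of_forall fun x => ?_)
    rw [Real.norm_eq_abs, Real.abs_exp, Real.exp_le_exp, abs_mul, abs_of_nonneg s.coe_nonneg]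
    exact mul_le_mul_of_nonneg_left (hle x) s.coe_nonneg
  have hDV := integral_le_klDiv_add hH (hφ.const_mul (s : ℝ)) hexp
    (integral_exp_le_monConj hA1 hQ hU hχ hint hE hφ hle ha hs')
  rw [integral_const_mul] at hDV
  have hfinal : (s * T : ℝ) ≤ (klDiv ν μ + monConj α (a * s)).toReal := by
    rw [hTφ, ENNReal.toReal_add hH hs']
    linarith
  have hmul : ((a * s : ℝ≥0) : ℝ≥0∞) * ((T / a : ℝ≥0) : ℝ≥0∞) = ENNReal.ofReal (s * T) := by
    rw [← ENNReal.coe_mul, ← NNReal.coe_mul, ENNReal.ofReal_coe_nnreal]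
    congr 1
    field_simp
  rw [hmul]
  exact (ENNReal.ofReal_le_iff_le_toReal (ENNReal.add_ne_top.2 ⟨hH, hs'⟩)).2 hfinal

lemma PinskerIneq.of_div [IsProbabilityMeasure μ] {l : ℝ≥0} (hl : 0 < l)
    (h : PinskerIneq α (fun x => χ x / l) μ a) : PinskerIneq α χ μ (a * l) := by
  intro ν _
  refine (le_of_eq ?_).trans (h ν)
  congr 1
  have : weightedTV (fun x => χ x / l) ν μ = (l : ℝ≥0∞)⁻¹ * weightedTV χ ν μ := by
    rw [weightedTV, weightedTV, ← lintegral_const_mul' _ _ (by simpa using hl.ne')]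
    refine lintegral_congr fun x => ?_
    rw [ENNReal.coe_div hl.ne', div_eq_mul_inv, mul_comm]
  rw [this, ENNReal.coe_mul, div_eq_mul_inv, div_eq_mul_inv,
    ENNReal.mul_inv (Or.inr (by simp)) (Or.inl (by simp))]
  ring

/-- The weighted Pinsker inequality is stable under decreasing limits of the constant. -/
lemma pinskerIneq_of_forall_gt (hα : IsConvexLsc α) [IsProbabilityMeasure μ] (ha : 0 < a)
    (h : ∀ a' > a, PinskerIneq α χ μ a') : PinskerIneq α χ μ a := by
  intro ν _
  rcases eq_or_ne (weightedTV χ ν μ) ∞ with hT | hT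
  · have h1 := h (a + 1) (lt_add_one a) ν
    rw [hT, ENNReal.top_div_coe] at h1
    rwa [hT, ENNReal.top_div_coe]
  · obtain ⟨T, hT⟩ : ∃ T : ℝ≥0, weightedTV χ ν μ = T := ⟨_, (ENNReal.coe_toNNReal hT).symm⟩
    have hval : ∀ b : ℝ≥0, 0 < b → extendTop α (weightedTV χ ν μ / b) = α (T / b) := by
      intro b hb
      rw [hT, ← ENNReal.coe_div hb.ne', extendTop_of_ne_top ENNReal.coe_ne_top,
        ENNReal.toNNReal_coe]
    rw [hval a ha]
    by_contra! hlt
    have hcont : ContinuousAt (fun b : ℝ≥0 => T / b) a :=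
      continuousAt_const.div continuousAt_id ha.ne'
    -- Lower semicontinuity carries a strict violation at `a` over to nearby `b > a`.
    have hev := hcont.eventually (hα.lsc (T / a) _ hlt)
    obtain ⟨b, hb, hab⟩ :=
      ((hev.filter_mono nhdsWithin_le_nhds).and (self_mem_nhdsWithin (s := Ioi a))).exists
    have h1 := h b hab ν
    rw [hval b (ha.trans hab)] at h1
    exact absurd h1 hb.not_ge

/-- The weighted Pinsker inequality with the constant `2 √2 m_α ‖χ‖`. -/
lemma pinskerIneq_of_luxNorm_le (hα : IsConvexLsc α) (hA1 : AssumptionA1 α)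
    (hQ : SuperQuadratic α s₀ c) (hU : AdmissibleU s₀ c u) [IsProbabilityMeasure μ]
    (hχ : Measurable χ) (hint : ∫⁻ x, (χ x : ℝ≥0∞) ∂μ < ∞) (ha : 0 < a)
    (h : ENNReal.ofReal (2 * Real.sqrt 2 * mConst α c u) *
      luxNorm α μ (fun x => (χ x : ℝ)) ≤ (a : ℝ≥0∞)) :
    PinskerIneq α χ μ a := by
  refine pinskerIneq_of_forall_gt hα ha fun a' ha' => ?_
  have hm := mConst_pos α c hU.pos
  set C : ℝ := 2 * Real.sqrt 2 * mConst α c u with hC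
  have hC0 : 0 < C := by positivity
  -- Strictness provides an admissible `l` with `C l < a'`, whether or not the infimum is attained
  -- and also when the norm is `0`.
  have hlt : luxNorm α μ (fun x => (χ x : ℝ)) < (a' : ℝ≥0∞) / ENNReal.ofReal C := by
    rw [ENNReal.lt_div_iff_mul_lt (by simp [hC0]) (by simp), mul_comm]
    exact h.trans_lt (by exact_mod_cast ha')
  obtain ⟨l, ⟨hl, hle⟩, hla⟩ := luxNorm_lt_iff.1 hlt
  rw [ENNReal.lt_div_iff_mul_lt (by simp [hC0]) (by simp)] at hla
  have hCa : C ≤ (a' / l : ℝ≥0) := by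
    have h1 := ENNReal.toReal_mono (by simp) hla.le
    rw [ENNReal.toReal_mul, ENNReal.toReal_ofReal hC0.le] at h1
    simp only [ENNReal.coe_toReal] at h1
    rw [NNReal.coe_div, le_div_iff₀ (by exact_mod_cast hl)]
    linarith
  rw [← div_mul_cancel₀ a' hl.ne']
  refine PinskerIneq.of_div hl (pinskerIneq_of_lintegral_expOf_le hα hA1 hQ hU
    (hχ.div_const l) ?_ ?_ hCa)
  · have : ∀ x, ((χ x / l : ℝ≥0) : ℝ≥0∞) = (l : ℝ≥0∞)⁻¹ * χ x := fun x => by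
      rw [ENNReal.coe_div hl.ne', div_eq_mul_inv, mul_comm]
    simp_rw [this]
    rw [lintegral_const_mul' _ _ (by simpa using hl.ne')]
    exact ENNReal.mul_lt_top (by simpa using hl) hint
  · simp only [NNReal.nnnorm_eq] at hle
    exact (lintegral_tau_le_one_iff α _).1 hle

lemma exists_admissibleU (hQ : SuperQuadratic α s₀ c) : ∃ u, AdmissibleU s₀ c u := by
  have hc : (0 : ℝ) < c := by exact_mod_cast hQ.c_pos
  have hs : (0 : ℝ) < s₀ := by exact_mod_cast hQ.s₀_pos
  set K : ℝ := s₀ * Real.sqrt c with hK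
  have hK0 : 0 < K := mul_pos hs (Real.sqrt_pos.2 hc)
  -- `u ≤ 1/2` gives `√(1 - u) ≥ 1/2`, so `u/√(1 - u) ≤ 2u ≤ K`.
  set u : ℝ := min (1 / 2) (K / 2) with hu
  have hu0 : 0 < u := by positivity
  have hu1 : u ≤ 1 / 2 := min_le_left _ _
  have hsq : 1 / 2 ≤ Real.sqrt (1 - u) := Real.le_sqrt_of_sq_le (by linarith)
  refine ⟨u, hu0, by linarith, ?_, ?_⟩
  · rw [div_le_iff₀ (by linarith)]
    have : u ≤ K / 2 := min_le_right _ _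
    nlinarith
  · rw [div_le_iff₀ (by linarith)]
    have : u ^ 3 ≤ 1 := pow_le_one₀ hu0.le (by linarith)
    linarith

end WeightedPinsker

theorem mainTheorem4 {X : Type*} [TopologicalSpace X] [PolishSpace X] [MeasurableSpace X]
    [BorelSpace X] (μ : Measure X) [IsProbabilityMeasure μ]
    (χ : X → ℝ≥0) (hχ : Measurable χ) (hχint : ∫⁻ x, (χ x : ℝ≥0∞) ∂μ < ∞)
    (α : ℝ≥0 → ℝ≥0∞) (hα : IsConvexLsc α) (hA1 : AssumptionA1 α) (hA2 : AssumptionA2 α) :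
    -- the equivalence
    ((∃ a : ℝ≥0, 0 < a ∧ PinskerIneq α χ μ a) ↔ MemOrlicz α μ (fun x => (χ x : ℝ))) ∧
    -- the constant in the inequality
    (MemOrlicz α μ (fun x => (χ x : ℝ)) →
      ∀ (s₀ c : ℝ≥0) (u : ℝ), SuperQuadratic α s₀ c → AdmissibleU s₀ c u →
        ∀ a : ℝ≥0, 0 < a →
          ENNReal.ofReal (2 * Real.sqrt 2 * mConst α c u) *
            luxNorm α μ (fun x => (χ x : ℝ)) ≤ (a : ℝ≥0∞) →
          PinskerIneq α χ μ a) ∧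
    -- the converse bounds
    (∀ a : ℝ≥0, 0 < a → PinskerIneq α χ μ a →
      ((∀ x, μ {x} = 0) → luxNorm α μ (fun x => (χ x : ℝ)) ≤ 3 * (a : ℝ≥0∞)) ∧
      (¬ (∀ x, μ {x} = 0) → luxNorm α μ (fun x => (χ x : ℝ)) ≤
        3 * (a : ℝ≥0∞) + (∫⁻ x, (χ x : ℝ≥0∞) ∂μ) * luxNorm α μ (fun _ => (1 : ℝ)))) ∧
    -- the estimate of the Luxemburg norm for an unbounded effective domain
    (effDom α = univ →
      ((luxNorm α μ (fun x => (χ x : ℝ)) : ℝ≥0∞) : EReal) ≤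
        ⨅ (δ : ℝ≥0) (_ : 0 < δ),
          ((1 / (δ : ℝ) : ℝ) : EReal) *
            (1 + ENNReal.log (∫⁻ x, expOf α (δ * χ x) ∂μ) / ((Real.log 2 : ℝ) : EReal))) ∧
    -- the case of a bounded effective domain
    (∀ r : ℝ≥0, (effDom α = Iio r ∨ effDom α = Iic r) →
      (∀ f : X → ℝ, MemOrlicz α μ f ↔ MemLp f ∞ μ) ∧
      (r : ℝ≥0∞)⁻¹ * eLpNorm (fun x => (χ x : ℝ)) ∞ μ ≤ luxNorm α μ (fun x => (χ x : ℝ)) ∧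
      luxNorm α μ (fun x => (χ x : ℝ)) ≤
        (⨆ (t : ℝ≥0) (_ : 0 < t ∧ α t ≤ ENNReal.ofReal (Real.log 2)), (t : ℝ≥0∞))⁻¹ *
          eLpNorm (fun x => (χ x : ℝ)) ∞ μ) := by
  have hmeas : AEMeasurable (fun x => (χ x : ℝ)) μ := hχ.coe_nnreal_real.aemeasurable
  refine ⟨⟨?_, ?_⟩, ?_, ?_, ?_, ?_⟩
  · rintro ⟨a, ha, hP⟩
    refine (memOrlicz_iff_luxNorm_lt_top hα hmeas).2
      ((luxNorm_le_of_pinskerIneq hα hA2 hχ hχint ha hP).trans_lt ?_)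
    have := luxNorm_one_lt_top hα hA2 (μ := μ)
    finiteness
  · intro h
    have hlux := (memOrlicz_iff_luxNorm_lt_top hα hmeas).1 h
    obtain ⟨s₀, c, hQ⟩ := hA2
    obtain ⟨u, hU⟩ := exists_admissibleU hQ
    have hfin : ENNReal.ofReal (2 * Real.sqrt 2 * mConst α c u) *
        luxNorm α μ (fun x => (χ x : ℝ)) ≠ ∞ := by finiteness
    obtain ⟨z, hz⟩ := ENNReal.lt_iff_exists_coe.1 hfin.lt_top
    -- Adding `1` keeps the constant positive when the norm is `0`.
    refine ⟨z + 1, by positivity,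
      pinskerIneq_of_luxNorm_le hα hA1 hQ hU hχ hχint (by positivity) ?_⟩
    rw [hz.1]
    exact_mod_cast le_self_add
  · intro _ s₀ c u hQ hU a ha hle
    exact pinskerIneq_of_luxNorm_le hα hA1 hQ hU hχ hχint ha hle
  · exact fun a ha hP => ⟨luxNorm_le_of_pinskerIneq_of_noAtoms hα hχ hχint ha hP,
      fun _ => luxNorm_le_of_pinskerIneq hα hA2 hχ hχint ha hP⟩
  · exact fun hdom => le_iInf₂ fun δ hδ => luxNorm_le_of_effDom_eq_univ hα hdom hδ
  · intro r hr
    have hr' : ∀ t, α t ≠ ∞ → t ≤ r := by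
      intro t ht
      have hmem : t ∈ effDom α := ht.lt_top
      rcases hr with hr | hr
      · rw [hr] at hmem
        exact hmem.le
      · rwa [hr] at hmem
    exact ⟨memOrlicz_iff_memLp_top hα hA2 hr', inv_mul_eLpNorm_le_luxNorm hα hr' hmeas,
      luxNorm_le_inv_iSup_mul hα hA2 hr' _⟩
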